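/- Consider the following search game. A treasure is hidden in one of $M\ge 1$ boxes according to a known probability distribution $f$ with $f(1)\ge f(2)\ge\dots\ge f(M)>0$, and $k$ players search for it in parallel during $T\ge 1$ rounds. A congestion policy $C$ is given, with $C(1)=1$, $C$ non-negative and non-increasing, and $C(k)<1$ (so $k\ge 2$). The triple $(C,f,T)$, together with $k$ and $M$, is called a configuration. A strategy is a probability distribution over sequences that prescribe, for each of the $T$ rounds, a box to visit or no visit. Its probability matrix is $A(x,t)$, the probability that box $x$ is visited for the first time in round $t$; strategies with the same matrix are regarded as equivalent. Write $\tilde A(x,t)=1-\sum_{s\le t}A(x,s)$. The value of box $x$ at round $t$ against $k-1$ players who all play $A$ is $$v_A(x,t)=f(x)\sum_{\ell=0}^{k-1}C(\ell+1)\binom{k-1}{\ell}A(x,t)^{\ell}\,\tilde A(x,t)^{k-1-\ell},$$ and the utility of a strategy $B$ against them is $U_A(B)=\sum_{t}\sum_{x}B(x,t)\,v_A(x,t)$. For $r\ge 1$, the strategy $A$ is a symmetric $r$-equilibrium if $U_A(B)\le r\,U_A(A)$ for every strategy $B$. Theorem. There is an algorithm (a single program for a real random access machine, in which each arithmetic operation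 or comparison of real numbers takes unit time) that, given any configuration and any $\theta>0$, outputs the probability matrix of a strategy that is a symmetric $(1+C(k))(1+\theta)$-equilibrium. Its running time is bounded by a fixed polynomial in $T$, $k$, $M$, $\max(0,\log(1/\theta))$, $\log(1/(1-C(k)))$ and $\log(1/f(M))$. -/

import Mathlib

/-! ## The search game -/

namespace SearchGame

/-- A configuration for `k` players: a congestion policy `C` (where `C ℓ` is the reward of each of
`ℓ ≥ 1` simultaneous first finders), a number `T` of rounds, and a positive non-increasing
probability distribution `f` on `M` boxes. As usual the policy is not constantly `1` on the
possible numbers `1, …, k` of finders. Boxes and rounds are numbered from `0`. -/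
structure Configuration where
  k : ℕ
  M : ℕ
  T : ℕ
  C : ℕ → ℝ
  f : Fin M → ℝ
  M_pos : 0 < M
  T_pos : 0 < T
  C_one : C 1 = 1
  C_nonneg : ∀ ℓ, 1 ≤ ℓ → 0 ≤ C ℓ
  C_anti : ∀ ℓ ℓ', 1 ≤ ℓ → ℓ ≤ ℓ' → C ℓ' ≤ C ℓ
  C_nondegenerate : ∃ ℓ, 1 ≤ ℓ ∧ ℓ ≤ k ∧ C ℓ < 1
  f_pos : ∀ x, 0 < f x
  f_anti : ∀ x y, x ≤ y → f y ≤ f x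
  f_sum : ∑ x, f x = 1

/-- The last box, the one with the smallest probability. -/
def Configuration.lastBox (c : Configuration) : Fin c.M :=
  ⟨c.M - 1, Nat.sub_lt c.M_pos Nat.one_pos⟩

/-- An execution: in each round the player visits a box, or stays idle (`none`). -/
abbrev Execution (M T : ℕ) : Type := Fin T → Option (Fin M)

/-- The execution `e` visits box `x` for the first time at round `t`. -/
def FirstVisit {M T : ℕ} (e : Execution M T) (x : Fin M) (t : Fin T) : Prop :=
  e t = some x ∧ ∀ s, s < t → e s ≠ some x

/-- A strategy is a probability distribution over executions. -/
structure Strategy (M T : ℕ) where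
  prob : Execution M T → ℝ
  prob_nonneg : ∀ e, 0 ≤ prob e
  prob_sum : ∑ e, prob e = 1

open Classical in
/-- The probability matrix of a strategy: the entry at `(x, t)` is the probability that box `x` is
visited for the first time at round `t`. -/
noncomputable def Strategy.matrix {M T : ℕ} (A : Strategy M T) (x : Fin M) (t : Fin T) : ℝ :=
  ∑ e, if FirstVisit e x t then A.prob e else 0

/-- The probability that box `x` is not visited by, and including, round `t`. -/
noncomputable def Strategy.notVisited {M T : ℕ} (A : Strategy M T) (x : Fin M) (t : Fin T) : ℝ :=
  1 - ∑ s ∈ Finset.univ.filter (fun s => s ≤ t), A.matrix x s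

/-- The value of box `x` at round `t` for an external player who plays against the profile `P`. -/
noncomputable def value (c : Configuration) {ι : Type} [Fintype ι] [DecidableEq ι]
    (P : ι → Strategy c.M c.T) (x : Fin c.M) (t : Fin c.T) : ℝ :=
  c.f x * ∑ ℓ ∈ Finset.range c.k, c.C (ℓ + 1) *
    ∑ I ∈ Finset.powersetCard ℓ (Finset.univ : Finset ι),
      (∏ i ∈ I, (P i).matrix x t) * ∏ i ∈ Iᶜ, (P i).notVisited x t

/-- The utility of the strategy `A` against the profile `P`. -/
noncomputable def utility (c : Configuration) {ι : Type} [Fintype ι] [DecidableEq ι]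
    (P : ι → Strategy c.M c.T) (A : Strategy c.M c.T) : ℝ :=
  ∑ t, ∑ x, A.matrix x t * value c P x t

/-- The profile of `k` players `P` is an `r`-equilibrium: no player can improve its utility against
the other players by more than a factor `r`, whichever strategy `B` it switches to. -/
def IsApproxEquilibrium (c : Configuration) (r : ℝ) (P : Fin c.k → Strategy c.M c.T) : Prop :=
  ∀ (i : Fin c.k) (B : Strategy c.M c.T),
    utility c (fun j : {j : Fin c.k // j ≠ i} => P j) B ≤
      r * utility c (fun j : {j : Fin c.k // j ≠ i} => P j) (P i)

/-- All `k` players playing `A` is an `r`-equilibrium. -/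
def IsSymmetricApproxEquilibrium (c : Configuration) (r : ℝ) (A : Strategy c.M c.T) : Prop :=
  IsApproxEquilibrium c r (fun _ => A)

end SearchGame

/-! ## The machine model: a real random access machine

The machine has registers that hold natural numbers, and arrays of cells that hold real numbers and
are addressed by natural numbers. A program is a finite text that names finitely many registers and
arrays. Arithmetic on reals (`+`, `-`, `*`, `/`), addition and truncated subtraction of naturals,
reading, writing and comparing all take unit time. There is no conversion between reals and
naturals, and no rounding. Division by `0` gives `0`, which a program could also obtain by a test. -/

namespace RealRAM

/-- A memory: natural number registers, and arrays of real cells. -/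
structure Memory where
  nat : ℕ → ℕ
  real : ℕ → ℕ → ℝ

/-- Expressions of natural number type. -/
inductive NatExp : Type
  | const (n : ℕ)
  | reg (r : ℕ)
  | add (a b : NatExp)
  | sub (a b : NatExp)

/-- The value of an expression. -/
def NatExp.eval (m : Memory) : NatExp → ℕ
  | .const n => n
  | .reg r => m.nat r
  | .add a b => a.eval m + b.eval m
  | .sub a b => a.eval m - b.eval m

/-- The number of operations that an expression takes. -/
def NatExp.cost : NatExp → ℕ
  | .const _ => 1
  | .reg _ => 1
  | .add a b => a.cost + b.cost + 1
  | .sub a b => a.cost + b.cost + 1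

/-- Expressions of real type; `cell a i` is the `i`-th cell of array `a`, and the only constants
are rational. -/
inductive RealExp : Type
  | const (q : ℚ)
  | cell (a : ℕ) (i : NatExp)
  | add (u v : RealExp)
  | sub (u v : RealExp)
  | mul (u v : RealExp)
  | div (u v : RealExp)

/-- The value of an expression. -/
noncomputable def RealExp.eval (m : Memory) : RealExp → ℝ
  | .const q => (q : ℝ)
  | .cell a i => m.real a (i.eval m)
  | .add u v => u.eval m + v.eval m
  | .sub u v => u.eval m - v.eval m
  | .mul u v => u.eval m * v.eval m
  | .div u v => u.eval m / v.eval m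

/-- The number of operations that an expression takes. -/
def RealExp.cost : RealExp → ℕ
  | .const _ => 1
  | .cell _ i => i.cost + 1
  | .add u v => u.cost + v.cost + 1
  | .sub u v => u.cost + v.cost + 1
  | .mul u v => u.cost + v.cost + 1
  | .div u v => u.cost + v.cost + 1

/-- Tests. -/
inductive Test : Type
  | natLt (a b : NatExp)
  | realLt (u v : RealExp)
  | not (p : Test)
  | and (p q : Test)

/-- The memory `m` passes the test. -/
def Test.Holds (m : Memory) : Test → Prop
  | .natLt a b => a.eval m < b.eval m
  | .realLt u v => u.eval m < v.eval m
  | .not p => ¬ p.Holds m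
  | .and p q => p.Holds m ∧ q.Holds m

/-- The number of operations that a test takes. -/
def Test.cost : Test → ℕ
  | .natLt a b => a.cost + b.cost + 1
  | .realLt u v => u.cost + v.cost + 1
  | .not p => p.cost + 1
  | .and p q => p.cost + q.cost + 1

/-- Programs. -/
inductive Program : Type
  | skip
  | setNat (r : ℕ) (a : NatExp)
  | setReal (a : ℕ) (i : NatExp) (u : RealExp)
  | seq (p q : Program)
  | branch (b : Test) (p q : Program)
  | loop (b : Test) (p : Program)

/-- `Runs p m n m'`: started on the memory `m`, the program `p` halts after `n` steps and leaves the
memory `m'`. The program `branch b p q` is `if b then p else q`, and `loop b p` is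
`while b do p`. -/
inductive Runs : Program → Memory → ℕ → Memory → Prop
  | skip (m : Memory) : Runs .skip m 1 m
  | setNat (r : ℕ) (a : NatExp) (m : Memory) :
      Runs (.setNat r a) m (a.cost + 1) { m with nat := Function.update m.nat r (a.eval m) }
  | setReal (a : ℕ) (i : NatExp) (u : RealExp) (m : Memory) :
      Runs (.setReal a i u) m (i.cost + u.cost + 1)
        { m with
          real := Function.update m.real a (Function.update (m.real a) (i.eval m) (u.eval m)) }
  | seq {p q : Program} {m m' m'' : Memory} {n n' : ℕ} :
      Runs p m n m' → Runs q m' n' m'' → Runs (.seq p q) m (n + n') m''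
  | branchTrue {b : Test} {p q : Program} {m m' : Memory} {n : ℕ} :
      b.Holds m → Runs p m n m' → Runs (.branch b p q) m (b.cost + n + 1) m'
  | branchFalse {b : Test} {p q : Program} {m m' : Memory} {n : ℕ} :
      ¬ b.Holds m → Runs q m n m' → Runs (.branch b p q) m (b.cost + n + 1) m'
  | loopTrue {b : Test} {p : Program} {m m' m'' : Memory} {n n' : ℕ} :
      b.Holds m → Runs p m n m' → Runs (.loop b p) m' n' m'' →
        Runs (.loop b p) m (b.cost + n + n' + 1) m''
  | loopFalse {b : Test} {p : Program} {m : Memory} :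
      ¬ b.Holds m → Runs (.loop b p) m (b.cost + 1) m

end RealRAM

/-! ## Input and output -/

namespace SearchGame

/-- The memory that holds the input `(c, θ)`: registers `0`, `1`, `2` hold `k`, `M`, `T`; array `0`
holds `θ` in cell `0`; array `1` holds `C ℓ` in cell `ℓ` for `1 ≤ ℓ ≤ k`; array `2` holds `f x` in
cell `x`. All the rest is `0`. -/
noncomputable def inputMemory (c : Configuration) (θ : ℝ) : RealRAM.Memory where
  nat := fun r => if r = 0 then c.k else if r = 1 then c.M else if r = 2 then c.T else 0
  real := fun a i =>
    if a = 0 then (if i = 0 then θ else 0)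
    else if a = 1 then (if 1 ≤ i ∧ i ≤ c.k then c.C i else 0)
    else if a = 2 then (if h : i < c.M then c.f ⟨i, h⟩ else 0)
    else 0

/-- The `M × T` matrix that is written, column by column, in array `3`. -/
def outputMatrix (M T : ℕ) (m : RealRAM.Memory) (x : Fin M) (t : Fin T) : ℝ :=
  m.real 3 (t.val * M + x.val)

/-- The quantities in which the running time is measured. The positive part of the logarithm is
there for `θ > 1` only: the arguments of the other two logarithms are at least `1`. -/
noncomputable def sizeParameters (c : Configuration) (θ : ℝ) : Fin 6 → ℝ :=
  ![(c.T : ℝ), (c.k : ℝ), (c.M : ℝ), max 0 (Real.log (1 / θ)),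
    Real.log (1 / (1 - c.C c.k)), Real.log (1 / c.f c.lastBox)]

end SearchGame

/-! The strategy is built greedily, each round being an approximate equilibrium given the earlier
ones. If a box is still unvisited with probability `w`, its value is `f` times a polynomial in the
probability `a` of visiting it now, with Bernstein coefficients `C 1, …, C k`, hence non-increasing
in `a`. A round has a threshold `α`: visited boxes are worth at least `α` (up to an error `η`),
boxes with `a < w` are worth at most `α`, and the visits sum to 1 unless `α = 0` (`IsRound`). Only
saturated boxes, those with `a = w`, can be worth more than `α`.

Why this is good enough (`sum_matrix_mul_symValue_le`): a deviator `B` earns at most the thresholds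
plus the excesses over them. A box has a positive excess in at most one round `t`, since after
saturation it is worthless. There its value is `C k * f * w ^ (k - 1)`, and `B` visits it with
probability at most `1 - w` more than `A` does. But `1 - w` is the probability that `A` visited the
box earlier, at rounds where it was worth at least `f * w ^ (k - 1)`. So the extra gain is at most
`C k` times what `A` earned there (`sum_excess_le`), which gives the factor `1 + C k` and an
additive error `T * M * η`. With two boxes or more, the utility of `A` is bounded below by about
`f(M) / 2 ^ (k - 1)` (`le_sum_matrix_mul_symValue`), and a small `η` turns the additive error into
the factor `1 + θ`. With a single box the utility can be 0, but then the computed rounds are exact.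

Computing a round: an inner bisection finds the response of a box to a given threshold, an outer one
finds two close thresholds whose responses sum to more than 1 and to at most 1. The value may be
nearly flat in `a`, so these responses can be far apart. Monotonicity still makes every number
between them an approximate response (`IsResponse.between`), and a convex combination has sum
exactly 1 (`isRound_interpolation`). Errors are measured in values, never in probabilities, so only
a Lipschitz bound matters and no lower bound on the slope. The number of bisection steps is linear
in `k + M + T` and the logarithms of `1 / θ` and `1 / f(M)`. By Birkhoff's theorem the resulting
doubly substochastic matrix comes from a strategy (`exists_strategy_matrix_eq`). -/

namespace SearchGame

/-! ### Polynomials in Bernstein form -/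

/-- The polynomial with Bernstein coefficients `c 0, …, c n`, by de Casteljau's recursion. -/
def bern : ℕ → (ℕ → ℝ) → ℝ → ℝ → ℝ
  | 0, c, _, _ => c 0
  | n + 1, c, a, b => b * bern n c a b + a * bern n (fun ℓ => c (ℓ + 1)) a b

theorem bern_eq_sum (n : ℕ) (c : ℕ → ℝ) (a b : ℝ) :
    bern n c a b = ∑ ℓ ∈ Finset.range (n + 1), c ℓ * (n.choose ℓ * (a ^ ℓ * b ^ (n - ℓ))) := by
  induction n generalizing c with
  | zero => simp [bern]
  | succ n ih =>
    rw [bern, ih, ih, Finset.sum_range_succ' _ (n + 1)]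
    have h1 : ∀ ℓ ∈ Finset.range (n + 1),
        c (ℓ + 1) * (((n + 1).choose (ℓ + 1) : ℕ) * (a ^ (ℓ + 1) * b ^ (n + 1 - (ℓ + 1))))
        = a * (c (ℓ + 1) * (n.choose ℓ * (a ^ ℓ * b ^ (n - ℓ))))
          + c (ℓ + 1) * (n.choose (ℓ + 1) * (a ^ (ℓ + 1) * b ^ (n - ℓ))) := by
      intro ℓ _
      rw [Nat.choose_succ_succ, Nat.add_sub_add_right]
      push_cast
      ring
    rw [Finset.sum_congr rfl h1, Finset.sum_add_distrib, ← Finset.mul_sum]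
    have h2 : ∑ ℓ ∈ Finset.range (n + 1),
          c (ℓ + 1) * (n.choose (ℓ + 1) * (a ^ (ℓ + 1) * b ^ (n - ℓ)))
        = b * ∑ ℓ ∈ Finset.range n,
          c (ℓ + 1) * (n.choose (ℓ + 1) * (a ^ (ℓ + 1) * b ^ (n - (ℓ + 1)))) := by
      rw [Finset.sum_range_succ, Nat.choose_succ_self, Finset.mul_sum]
      simp only [Nat.cast_zero, zero_mul, mul_zero, add_zero]
      refine Finset.sum_congr rfl fun ℓ hℓ => ?_
      have h3 : n - ℓ = n - (ℓ + 1) + 1 := by have := Finset.mem_range.1 hℓ; omega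
      rw [h3, pow_succ b]
      ring
    rw [h2, Finset.sum_range_succ' _ n]
    simp only [Nat.choose_zero_right, Nat.cast_one, pow_zero, Nat.sub_zero]
    ring

theorem bern_congr {n : ℕ} {c c' : ℕ → ℝ} (h : ∀ ℓ ≤ n, c ℓ = c' ℓ) (a b : ℝ) :
    bern n c a b = bern n c' a b := by
  rw [bern_eq_sum, bern_eq_sum]
  refine Finset.sum_congr rfl fun ℓ hℓ => ?_
  rw [h ℓ (Nat.lt_succ_iff.1 (Finset.mem_range.1 hℓ))]

theorem bern_mono {n : ℕ} {c c' : ℕ → ℝ} (h : ∀ ℓ, c ℓ ≤ c' ℓ) {a b : ℝ} (ha : 0 ≤ a)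
    (hb : 0 ≤ b) : bern n c a b ≤ bern n c' a b := by
  induction n generalizing c c' with
  | zero => exact h 0
  | succ n ih =>
    exact add_le_add (mul_le_mul_of_nonneg_left (ih h) hb)
      (mul_le_mul_of_nonneg_left (ih fun ℓ => h (ℓ + 1)) ha)

theorem bern_nonneg {n : ℕ} {c : ℕ → ℝ} (h : ∀ ℓ, 0 ≤ c ℓ) {a b : ℝ} (ha : 0 ≤ a) (hb : 0 ≤ b) :
    0 ≤ bern n c a b := by
  rw [bern_eq_sum]
  exact Finset.sum_nonneg fun ℓ _ => mul_nonneg (h ℓ) (by positivity)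

theorem pow_mul_le_bern {n : ℕ} {c : ℕ → ℝ} (h : ∀ ℓ, 0 ≤ c ℓ) {a b : ℝ} (ha : 0 ≤ a)
    (hb : 0 ≤ b) : b ^ n * c 0 ≤ bern n c a b := by
  induction n with
  | zero => simp [bern]
  | succ n ih =>
    rw [bern, pow_succ']
    have := mul_nonneg ha (bern_nonneg (n := n) (fun ℓ => h (ℓ + 1)) ha hb)
    nlinarith [mul_le_mul_of_nonneg_left ih hb]

theorem bern_le_pow {n : ℕ} {c : ℕ → ℝ} (h : ∀ ℓ, c ℓ ≤ 1) {a b : ℝ} (ha : 0 ≤ a) (hb : 0 ≤ b) :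
    bern n c a b ≤ (a + b) ^ n := by
  induction n generalizing c with
  | zero => simpa [bern] using h 0
  | succ n ih =>
    rw [bern, pow_succ']
    nlinarith [mul_le_mul_of_nonneg_left (ih h) hb,
      mul_le_mul_of_nonneg_left (ih fun ℓ => h (ℓ + 1)) ha]

theorem bern_zero_right (n : ℕ) (c : ℕ → ℝ) (a : ℝ) : bern n c a 0 = c n * a ^ n := by
  induction n generalizing c with
  | zero => simp [bern]
  | succ n ih => rw [bern, ih (fun ℓ => c (ℓ + 1)), pow_succ]; ring

/-- Increasing `a` at fixed `a + b = w` moves weight from the coefficients `c ℓ` to the smaller `c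
(ℓ + 1)` in each step of the recursion. Thus a box loses value as the opponents visit it more. -/
theorem bern_antitone {n : ℕ} {c : ℕ → ℝ} (hc : Antitone c) {w a a' : ℝ}
    (ha : 0 ≤ a) (h : a ≤ a') (hw : a' ≤ w) :
    bern n c a' (w - a') ≤ bern n c a (w - a) := by
  induction n generalizing c with
  | zero => exact le_rfl
  | succ n ih =>
    have h1 := ih hc
    have h2 := ih (c := fun ℓ => c (ℓ + 1)) (fun i j hij => hc (Nat.succ_le_succ hij))
    have h3 : bern n (fun ℓ => c (ℓ + 1)) a' (w - a') ≤ bern n c a' (w - a') :=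
      bern_mono (fun ℓ => hc (Nat.le_succ ℓ)) (ha.trans h) (sub_nonneg.2 hw)
    rw [bern, bern]
    nlinarith [mul_nonneg (sub_nonneg.2 h) (sub_nonneg.2 h3),
      mul_nonneg (sub_nonneg.2 (h.trans hw)) (sub_nonneg.2 h1), mul_nonneg ha (sub_nonneg.2 h2)]

/-- Along `a + b = w` the derivative is `n` times a Bernstein polynomial of degree `n - 1` in the
differences of consecutive coefficients, which lie in `[-1, 1]`. The induction replaces this: each
step of the recursion adds one `a' - a`. -/
theorem bern_lipschitz {n : ℕ} {c : ℕ → ℝ} (hc0 : ∀ ℓ, 0 ≤ c ℓ) (hc1 : ∀ ℓ, c ℓ ≤ 1) {w a a' : ℝ}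
    (ha : 0 ≤ a) (h : a ≤ a') (hw : a' ≤ w) (hw1 : w ≤ 1) :
    bern n c a (w - a) ≤ bern n c a' (w - a') + n * (a' - a) := by
  induction n generalizing c with
  | zero => simp [bern]
  | succ n ih =>
    have h1 := ih hc0 hc1
    have h2 := ih (c := fun ℓ => c (ℓ + 1)) (fun ℓ => hc0 (ℓ + 1)) (fun ℓ => hc1 (ℓ + 1))
    have hb : 0 ≤ w - a := sub_nonneg.2 (h.trans hw)
    have h3 : bern n c a (w - a) ≤ 1 :=
      (bern_le_pow hc1 ha hb).trans (pow_le_one₀ (by linarith) (by linarith))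
    have h4 : 0 ≤ bern n (fun ℓ => c (ℓ + 1)) a (w - a) := bern_nonneg (fun ℓ => hc0 (ℓ + 1)) ha hb
    rw [bern, bern]
    have h5 : 0 ≤ (n : ℝ) * (a' - a) := mul_nonneg n.cast_nonneg (sub_nonneg.2 h)
    push_cast
    nlinarith [mul_nonneg (sub_nonneg.2 hw) (sub_nonneg.2 h1),
      mul_nonneg (ha.trans h) (sub_nonneg.2 h2), mul_nonneg (sub_nonneg.2 h) (sub_nonneg.2 h3),
      mul_nonneg (sub_nonneg.2 h) h4, mul_nonneg (sub_nonneg.2 hw1) h5]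

/-! ### Probability matrices of strategies -/

section Matrices

variable {M T : ℕ}

theorem Strategy.matrix_nonneg (A : Strategy M T) (x : Fin M) (t : Fin T) : 0 ≤ A.matrix x t := by
  unfold Strategy.matrix
  refine Finset.sum_nonneg fun e _ => ?_
  split_ifs
  exacts [A.prob_nonneg e, le_rfl]

theorem FirstVisit.unique {e : Execution M T} {x : Fin M} {s t : Fin T} (hs : FirstVisit e x s)
    (ht : FirstVisit e x t) : s = t := by
  rcases lt_trichotomy s t with h | h | h
  · exact absurd hs.1 (ht.2 s h)
  · exact h
  · exact absurd ht.1 (hs.2 t h)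

open Classical in
theorem sum_ite_le_of_subsingleton {ι : Type*} [Fintype ι] {p : ι → Prop}
    (hp : ∀ i j, p i → p j → i = j) {r : ℝ} (hr : 0 ≤ r) : ∑ i, (if p i then r else 0) ≤ r := by
  by_cases h : ∃ i, p i
  · obtain ⟨i, hi⟩ := h
    rw [Finset.sum_eq_single i (fun j _ hj => if_neg fun h => hj (hp j i h hi)) (by simp), if_pos hi]
  · push Not at h
    simpa [h] using hr

theorem Strategy.sum_matrix_row_le (A : Strategy M T) (x : Fin M) : ∑ t, A.matrix x t ≤ 1 := by
  classical
  unfold Strategy.matrix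
  rw [Finset.sum_comm, ← A.prob_sum]
  refine Finset.sum_le_sum fun e _ => ?_
  convert sum_ite_le_of_subsingleton (fun s t hs ht => FirstVisit.unique (e := e) (x := x) hs ht)
    (A.prob_nonneg e)

theorem Strategy.sum_matrix_col_le (A : Strategy M T) (t : Fin T) : ∑ x, A.matrix x t ≤ 1 := by
  classical
  unfold Strategy.matrix
  rw [Finset.sum_comm, ← A.prob_sum]
  refine Finset.sum_le_sum fun e _ => ?_
  convert sum_ite_le_of_subsingleton (p := fun x => FirstVisit e x t)
    (fun x y hx hy => Option.some_injective _ (hx.1.symm.trans hy.1)) (A.prob_nonneg e)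

/-- The symmetric doubly stochastic matrix that completes a doubly substochastic one. -/
def completion (a : Fin M → Fin T → ℝ) : Matrix (Fin M ⊕ Fin T) (Fin M ⊕ Fin T) ℝ :=
  Matrix.fromBlocks (Matrix.diagonal fun x => 1 - ∑ t, a x t) (Matrix.of a) (Matrix.of a).transpose
    (Matrix.diagonal fun t => 1 - ∑ x, a x t)

/-- The diagonal blocks absorb the mass missing from the rows and columns of `a`. -/
theorem completion_mem_doublyStochastic {a : Fin M → Fin T → ℝ} (h0 : ∀ x t, 0 ≤ a x t)
    (hrow : ∀ x, ∑ t, a x t ≤ 1) (hcol : ∀ t, ∑ x, a x t ≤ 1) :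
    completion a ∈ doublyStochastic ℝ (Fin M ⊕ Fin T) := by
  rw [mem_doublyStochastic_iff_sum]
  refine ⟨?_, ?_, ?_⟩
  · rintro (x | s) (y | t)
    · by_cases h : x = y <;> simp [completion, Matrix.diagonal, h, hrow]
    · exact h0 x t
    · exact h0 y s
    · by_cases h : s = t <;> simp [completion, Matrix.diagonal, h, hcol]
  · rintro (x | s) <;> simp [completion, Fintype.sum_sum_type, Matrix.diagonal_apply]
  · rintro (x | s) <;> simp [completion, Fintype.sum_sum_type, Matrix.diagonal_apply]

/-- The execution that visits box `x` in round `t` when `σ` sends `x` to `t`. -/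
def permExecution (σ : Equiv.Perm (Fin M ⊕ Fin T)) : Execution M T :=
  fun t => (σ.symm (Sum.inr t)).getLeft?

theorem permExecution_eq_some {σ : Equiv.Perm (Fin M ⊕ Fin T)} {x : Fin M} {t : Fin T} :
    permExecution σ t = some x ↔ σ (Sum.inl x) = Sum.inr t := by
  rw [permExecution, Sum.getLeft?_eq_some_iff, Equiv.symm_apply_eq, eq_comm]

/-- `σ` sends a box to one place only, so no box is visited twice and every visit is a first visit.
-/
theorem firstVisit_permExecution {σ : Equiv.Perm (Fin M ⊕ Fin T)} {x : Fin M} {t : Fin T} :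
    FirstVisit (permExecution σ) x t ↔ σ (Sum.inl x) = Sum.inr t := by
  rw [FirstVisit, permExecution_eq_some, and_iff_left_iff_imp]
  intro h s hs h'
  rw [permExecution_eq_some, h] at h'
  exact hs.ne' (Sum.inr_injective h')

/-- Every doubly substochastic matrix is the probability matrix of a strategy. -/
theorem exists_strategy_matrix_eq {a : Fin M → Fin T → ℝ} (h0 : ∀ x t, 0 ≤ a x t)
    (hrow : ∀ x, ∑ t, a x t ≤ 1) (hcol : ∀ t, ∑ x, a x t ≤ 1) :
    ∃ A : Strategy M T, A.matrix = a := by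
  classical
  -- Birkhoff–von Neumann: the strategy draws `σ` with probability `p σ` and executes it. Several
  -- permutations can give the same execution, so their weights are added.
  obtain ⟨p, hp0, hp1, hp⟩ := exists_eq_sum_perm_of_mem_doublyStochastic
    (completion_mem_doublyStochastic h0 hrow hcol)
  refine ⟨⟨fun e => ∑ σ, if permExecution σ = e then p σ else 0, fun e => ?_, ?_⟩, ?_⟩
  · exact Finset.sum_nonneg fun σ _ => by split_ifs; exacts [hp0 σ, le_rfl]
  · rw [Finset.sum_comm, ← hp1]
    simp
  · funext x t
    have h := congrFun (congrFun hp (Sum.inl x)) (Sum.inr t)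
    rw [Matrix.sum_apply] at h
    have h2 : completion a (Sum.inl x) (Sum.inr t) = a x t := rfl
    rw [← h2, ← h]
    unfold Strategy.matrix
    have h3 : ∀ e : Execution M T,
        (if FirstVisit e x t then ∑ σ, (if permExecution σ = e then p σ else 0) else 0)
        = ∑ σ, if permExecution σ = e then (if FirstVisit (permExecution σ) x t then p σ else 0)
          else 0 := by
      intro e
      split_ifs with he
      · refine Finset.sum_congr rfl fun σ _ => ?_
        split_ifs with h4 h5
        · rfl
        · exact absurd (h4 ▸ he) h5
        · rfl
      · refine (Finset.sum_eq_zero fun σ _ => ?_).symm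
        split_ifs with h4 h5
        · exact absurd (h4 ▸ h5) he
        · rfl
        · rfl
    calc _ = ∑ e : Execution M T, ∑ σ, if permExecution σ = e then
            (if FirstVisit (permExecution σ) x t then p σ else 0) else 0 := by
          refine Finset.sum_congr rfl fun e _ => ?_
          rw [← h3 e]
      _ = ∑ σ, if FirstVisit (permExecution σ) x t then p σ else 0 := by
          rw [Finset.sum_comm]
          simp
      _ = _ := by
          refine Finset.sum_congr rfl fun σ _ => ?_
          simp [firstVisit_permExecution, Equiv.Perm.permMatrix, PEquiv.toMatrix_apply,
            Equiv.toPEquiv_apply, eq_comm]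

end Matrices

/-! ### Approximate round equilibria -/

section Equilibrium

variable (c : Configuration)

theorem Configuration.two_le_k : 2 ≤ c.k := by
  obtain ⟨ℓ, h1, h2, h3⟩ := c.C_nondegenerate
  rcases h1.eq_or_lt with rfl | h
  · exact absurd c.C_one h3.ne
  · omega

theorem Configuration.C_last_nonneg : 0 ≤ c.C c.k :=
  c.C_nonneg _ (one_le_two.trans c.two_le_k)

theorem Configuration.f_le_one (x : Fin c.M) : c.f x ≤ 1 :=
  c.f_sum ▸ Finset.single_le_sum (f := c.f) (fun y _ => (c.f_pos y).le) (Finset.mem_univ x)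

/-- The coefficients of the value of a box, as a polynomial in Bernstein form. -/
def Configuration.coeff (ℓ : ℕ) : ℝ := c.C (ℓ + 1)

theorem Configuration.coeff_nonneg (ℓ : ℕ) : 0 ≤ c.coeff ℓ := c.C_nonneg _ (Nat.succ_pos ℓ)

theorem Configuration.coeff_antitone : Antitone c.coeff :=
  fun i _ h => c.C_anti _ _ (Nat.succ_pos i) (Nat.succ_le_succ h)

theorem Configuration.coeff_le_one (ℓ : ℕ) : c.coeff ℓ ≤ 1 :=
  (c.coeff_antitone (Nat.zero_le ℓ)).trans_eq c.C_one

/-- All subsets of `ℓ` among the `k - 1` opponents contribute equally, which leaves a binomial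
coefficient. -/
theorem value_symmetric (A : Strategy c.M c.T) (i : Fin c.k) (x : Fin c.M) (t : Fin c.T) :
    value c (fun _ : {j : Fin c.k // j ≠ i} => A) x t
      = c.f x * bern (c.k - 1) c.coeff (A.matrix x t) (A.notVisited x t) := by
  have hk : c.k - 1 + 1 = c.k := Nat.sub_add_cancel (one_le_two.trans c.two_le_k)
  have hcard : Fintype.card {j : Fin c.k // j ≠ i} = c.k - 1 := by
    rw [Fintype.card_subtype_compl]
    simp
  rw [value, bern_eq_sum, hk]
  congr 1
  refine Finset.sum_congr rfl fun ℓ _ => ?_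
  have h : ∀ I ∈ Finset.powersetCard ℓ (Finset.univ : Finset {j : Fin c.k // j ≠ i}),
      (∏ _i ∈ I, A.matrix x t) * ∏ _i ∈ Iᶜ, A.notVisited x t
        = A.matrix x t ^ ℓ * A.notVisited x t ^ (c.k - 1 - ℓ) := by
    intro I hI
    rw [Finset.prod_const, Finset.prod_const, Finset.card_compl, hcard,
      (Finset.mem_powersetCard.1 hI).2]
  rw [Finset.sum_congr rfl h, Finset.sum_const, Finset.card_powersetCard, Finset.card_univ, hcard,
    nsmul_eq_mul]
  rfl

/-- `a` is, up to the error `η`, an equilibrium with threshold `α` of the single round in which box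
`x` is unvisited with probability `w x`. -/
structure IsRound {M : ℕ} (n : ℕ) (b : ℕ → ℝ) (f w a : Fin M → ℝ) (η α : ℝ) : Prop where
  nonneg : ∀ x, 0 ≤ a x
  le : ∀ x, a x ≤ w x
  sum_le : ∑ x, a x ≤ 1
  threshold_nonneg : 0 ≤ α
  -- With `sum_le`, this says that `α = 0` or that the sum is 1.
  full : α ≤ α * ∑ x, a x
  -- The deficit is weighted by `a x`, as it is in the utility: a box that is hardly visited may
  -- fall far short of `α`.
  lower : ∀ x, a x * (α - f x * bern n b (a x) (w x - a x)) ≤ η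
  upper : ∀ x, a x < w x → f x * bern n b (a x) (w x - a x) ≤ α

variable {c}

/-- The probability that box `x` is not visited before round `t`. -/
noncomputable def Strategy.unvisited {M T : ℕ} (A : Strategy M T) (t : Fin T) (x : Fin M) : ℝ :=
  1 - ∑ s ∈ Finset.univ.filter (fun s => s < t), A.matrix x s

theorem Strategy.notVisited_eq {M T : ℕ} (A : Strategy M T) (x : Fin M) (t : Fin T) :
    A.notVisited x t = A.unvisited t x - A.matrix x t := by
  have h : Finset.univ.filter (fun s => s ≤ t) = insert t (Finset.univ.filter (fun s => s < t)) := by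
    ext s
    simp [le_iff_eq_or_lt]
  rw [Strategy.notVisited, Strategy.unvisited, h, Finset.sum_insert (by simp)]
  ring

theorem Strategy.unvisited_le_notVisited {M T : ℕ} (A : Strategy M T) (x : Fin M) {s t : Fin T}
    (h : s < t) : A.unvisited t x ≤ A.notVisited x s := by
  unfold Strategy.notVisited Strategy.unvisited
  refine sub_le_sub_left (Finset.sum_le_sum_of_subset_of_nonneg (fun r hr => ?_)
    fun r _ _ => A.matrix_nonneg x r) 1
  simp only [Finset.mem_filter, Finset.mem_univ, true_and] at hr ⊢
  exact hr.trans_lt h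

theorem Strategy.unvisited_nonneg {M T : ℕ} (A : Strategy M T) (x : Fin M) (t : Fin T) :
    0 ≤ A.unvisited t x :=
  sub_nonneg.2 ((Finset.sum_le_sum_of_subset_of_nonneg (Finset.filter_subset _ _)
    fun r _ _ => A.matrix_nonneg x r).trans (A.sum_matrix_row_le x))

theorem Strategy.notVisited_nonneg {M T : ℕ} (A : Strategy M T) (x : Fin M) (t : Fin T) :
    0 ≤ A.notVisited x t :=
  sub_nonneg.2 ((Finset.sum_le_sum_of_subset_of_nonneg (Finset.filter_subset _ _)
    fun r _ _ => A.matrix_nonneg x r).trans (A.sum_matrix_row_le x))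

/-- The value of box `x` at round `t` against players who all play `A`. -/
noncomputable def symValue (c : Configuration) (A : Strategy c.M c.T) (x : Fin c.M) (t : Fin c.T) :
    ℝ := c.f x * bern (c.k - 1) c.coeff (A.matrix x t) (A.notVisited x t)

theorem symValue_nonneg (A : Strategy c.M c.T) (x : Fin c.M) (t : Fin c.T) :
    0 ≤ symValue c A x t :=
  mul_nonneg (c.f_pos x).le (bern_nonneg c.coeff_nonneg (A.matrix_nonneg x t)
    (A.notVisited_nonneg x t))

/-- Only the event that no opponent has come by round `t` is kept; its reward is `C 1 = 1`. -/
theorem pow_le_symValue (A : Strategy c.M c.T) (x : Fin c.M) (t : Fin c.T) :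
    c.f x * A.notVisited x t ^ (c.k - 1) ≤ symValue c A x t := by
  refine mul_le_mul_of_nonneg_left ?_ (c.f_pos x).le
  have := pow_mul_le_bern (n := c.k - 1) c.coeff_nonneg (A.matrix_nonneg x t)
    (A.notVisited_nonneg x t)
  rwa [show c.coeff 0 = 1 from c.C_one, mul_one] at this

/-- At saturation every opponent has come by round `t`, so only the event that all `k - 1` come
exactly now yields a reward from which earlier visits do not detract. -/
theorem symValue_saturated (A : Strategy c.M c.T) {x : Fin c.M} {t : Fin c.T}
    (h : A.matrix x t = A.unvisited t x) :
    symValue c A x t = c.C c.k * (c.f x * A.unvisited t x ^ (c.k - 1)) := by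
  have hk : c.k - 1 + 1 = c.k := Nat.sub_add_cancel (one_le_two.trans c.two_le_k)
  rw [symValue, A.notVisited_eq, h, sub_self, bern_zero_right, Configuration.coeff, hk]
  ring

/-- There is at least one opponent, and it has certainly been at the box before round `t`. -/
theorem symValue_eq_zero_of_saturated (A : Strategy c.M c.T) {x : Fin c.M} {s t : Fin c.T}
    (h : A.matrix x s = A.unvisited s x) (hst : s < t) : symValue c A x t = 0 := by
  have hk : c.k - 1 ≠ 0 := by have := c.two_le_k; omega
  have h1 : A.unvisited t x = 0 := by
    refine le_antisymm ((A.unvisited_le_notVisited x hst).trans_eq ?_) (A.unvisited_nonneg x t)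
    rw [A.notVisited_eq, h, sub_self]
  have h2 : A.matrix x t = 0 := by
    have h3 := A.notVisited_nonneg x t
    rw [A.notVisited_eq, h1] at h3
    linarith [A.matrix_nonneg x t]
  rw [symValue_saturated A (h2.trans h1.symm), h1, zero_pow hk]
  ring

/-- This is the source of the term `C k`: what `B` gains over `A` from the excess of a box is paid
for by what `A` collected from that box before saturating it. -/
theorem sum_excess_le {A : Strategy c.M c.T} {η : ℝ} {α : Fin c.T → ℝ}
    (hA : ∀ t, IsRound (c.k - 1) c.coeff c.f (A.unvisited t) (fun x => A.matrix x t) η (α t))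
    (B : Strategy c.M c.T) (x : Fin c.M) :
    ∑ t, (B.matrix x t - A.matrix x t) * max (symValue c A x t - α t) 0
      ≤ c.C c.k * ∑ t, A.matrix x t * symValue c A x t := by
  have hav : ∀ t, 0 ≤ A.matrix x t * symValue c A x t :=
    fun t => mul_nonneg (A.matrix_nonneg x t) (symValue_nonneg A x t)
  have hsat : ∀ t, α t < symValue c A x t → A.matrix x t = A.unvisited t x := by
    intro t ht
    by_contra h
    have h1 := (hA t).upper x (lt_of_le_of_ne ((hA t).le x) h)
    rw [← A.notVisited_eq] at h1
    exact absurd ht h1.not_gt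
  by_cases hex : ∃ t, α t < symValue c A x t
  · obtain ⟨t, ht⟩ := hex
    have hs := hsat t ht
    -- Two rounds with an excess would both saturate the box; the later value would be 0, which
    -- exceeds no threshold.
    have hzero : ∀ s, s ≠ t → max (symValue c A x s - α s) 0 = 0 := by
      intro s hst
      refine max_eq_right (sub_nonpos.2 (not_lt.1 fun h => ?_))
      rcases lt_or_gt_of_ne hst with h1 | h1
      · rw [symValue_eq_zero_of_saturated A (hsat s h) h1] at ht
        exact absurd ht (hA t).threshold_nonneg.not_gt
      · rw [symValue_eq_zero_of_saturated A hs h1] at h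
        exact absurd h (hA s).threshold_nonneg.not_gt
    rw [Finset.sum_eq_single t (fun s _ hst => by rw [hzero s hst, mul_zero]) (by simp),
      max_eq_left (sub_nonneg.2 ht.le), hs]
    have hB : B.matrix x t ≤ 1 :=
      (Finset.single_le_sum (f := fun t => B.matrix x t) (fun s _ => B.matrix_nonneg x s)
        (Finset.mem_univ t)).trans (B.sum_matrix_row_le x)
    have hw1 : A.unvisited t x ≤ 1 :=
      sub_le_self _ (Finset.sum_nonneg fun s _ => A.matrix_nonneg x s)
    have hfw : 0 ≤ c.f x * A.unvisited t x ^ (c.k - 1) :=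
      mul_nonneg (c.f_pos x).le (pow_nonneg (A.unvisited_nonneg x t) _)
    have h1 : (B.matrix x t - A.unvisited t x) * (symValue c A x t - α t)
        ≤ (1 - A.unvisited t x) * (c.C c.k * (c.f x * A.unvisited t x ^ (c.k - 1))) := by
      rw [symValue_saturated A hs] at ht ⊢
      exact mul_le_mul (by linarith) (by linarith [(hA t).threshold_nonneg]) (by linarith)
        (by linarith)
    refine h1.trans ?_
    rw [mul_left_comm]
    refine mul_le_mul_of_nonneg_left ?_ c.C_last_nonneg
    -- The factor `1 - w` is the probability of earlier visits by `A`. At each earlier round `s` the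
    -- box stays unvisited through `s` with probability at least `w`, so its value was at least `f *
    -- w ^ (k - 1)`.
    have h2 : 1 - A.unvisited t x = ∑ s ∈ Finset.univ.filter (fun s => s < t), A.matrix x s := by
      unfold Strategy.unvisited
      ring
    rw [h2, Finset.sum_mul]
    refine (Finset.sum_le_sum fun s hs' => ?_).trans
      (Finset.sum_le_sum_of_subset_of_nonneg (Finset.filter_subset _ _) fun s _ _ => hav s)
    have h3 : s < t := by simpa using hs'
    refine mul_le_mul_of_nonneg_left ?_ (A.matrix_nonneg x s)
    refine (mul_le_mul_of_nonneg_left ?_ (c.f_pos x).le).trans (pow_le_symValue A x s)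
    exact pow_le_pow_left₀ (A.unvisited_nonneg x t) (A.unvisited_le_notVisited x h3) _
  · push Not at hex
    have h : ∀ t, max (symValue c A x t - α t) 0 = 0 := fun t => max_eq_right (by linarith [hex t])
    simp only [h, mul_zero, Finset.sum_const_zero]
    exact mul_nonneg c.C_last_nonneg (Finset.sum_nonneg fun t _ => hav t)

/-- For each entry, `a * α + a * (v - α)⁺ = a * max v α`, which `lower` bounds by `a * v + η`.
Summing over the boxes of a round recovers `α` itself by `full`. -/
theorem sum_threshold_le {A : Strategy c.M c.T} {η : ℝ} {α : Fin c.T → ℝ}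
    (hη : 0 ≤ η)
    (hA : ∀ t, IsRound (c.k - 1) c.coeff c.f (A.unvisited t) (fun x => A.matrix x t) η (α t)) :
    ∑ t, α t + ∑ t, ∑ x, A.matrix x t * max (symValue c A x t - α t) 0
      ≤ ∑ t, ∑ x, A.matrix x t * symValue c A x t + c.T * c.M * η := by
  have h : ∀ t, α t + ∑ x, A.matrix x t * max (symValue c A x t - α t) 0
      ≤ ∑ x, A.matrix x t * symValue c A x t + c.M * η := by
    intro t
    have h1 : ∀ x, A.matrix x t * α t + A.matrix x t * max (symValue c A x t - α t) 0
        ≤ A.matrix x t * symValue c A x t + η := by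
      intro x
      have h2 := (hA t).lower x
      rw [← A.notVisited_eq] at h2
      change A.matrix x t * (α t - symValue c A x t) ≤ η at h2
      rcases max_cases (symValue c A x t - α t) 0 with h3 | h3 <;> rw [h3.1] <;> nlinarith
    have h4 := Finset.sum_le_sum fun x (_ : x ∈ Finset.univ) => h1 x
    rw [Finset.sum_add_distrib, Finset.sum_add_distrib, ← Finset.sum_mul, Finset.sum_const,
      Finset.card_univ, Fintype.card_fin, nsmul_eq_mul] at h4
    have h5 := (hA t).full
    linarith
  have h6 := Finset.sum_le_sum fun t (_ : t ∈ Finset.univ) => h t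
  rw [Finset.sum_add_distrib, Finset.sum_add_distrib, Finset.sum_const, Finset.card_univ,
    Fintype.card_fin, nsmul_eq_mul] at h6
  linarith

/-- Split `v ≤ α + (v - α)⁺`. The columns of `B` sum to at most 1, so its first part is at most the
sum of the thresholds; replacing `B` by `A` in the second part costs `sum_excess_le`. -/
theorem sum_matrix_mul_symValue_le {A : Strategy c.M c.T} {η : ℝ} {α : Fin c.T → ℝ}
    (hη : 0 ≤ η)
    (hA : ∀ t, IsRound (c.k - 1) c.coeff c.f (A.unvisited t) (fun x => A.matrix x t) η (α t))
    (B : Strategy c.M c.T) :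
    ∑ t, ∑ x, B.matrix x t * symValue c A x t
      ≤ (1 + c.C c.k) * (∑ t, ∑ x, A.matrix x t * symValue c A x t) + c.T * c.M * η := by
  have h1 : ∑ t, ∑ x, B.matrix x t * symValue c A x t
      ≤ ∑ t, α t + ∑ t, ∑ x, B.matrix x t * max (symValue c A x t - α t) 0 := by
    rw [← Finset.sum_add_distrib]
    refine Finset.sum_le_sum fun t _ => ?_
    have h2 : ∑ x, B.matrix x t * symValue c A x t
        ≤ ∑ x, (B.matrix x t * α t + B.matrix x t * max (symValue c A x t - α t) 0) := by
      refine Finset.sum_le_sum fun x _ => ?_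
      rw [← mul_add]
      exact mul_le_mul_of_nonneg_left (by linarith [le_max_left (symValue c A x t - α t) 0])
        (B.matrix_nonneg x t)
    rw [Finset.sum_add_distrib, ← Finset.sum_mul] at h2
    nlinarith [B.sum_matrix_col_le t, (hA t).threshold_nonneg]
  have h2 := sum_threshold_le hη hA
  have h3 := Finset.sum_le_sum fun x (_ : x ∈ Finset.univ) => sum_excess_le hA B x
  rw [← Finset.mul_sum] at h3
  simp only [sub_mul, Finset.sum_sub_distrib] at h3
  rw [Finset.sum_comm (f := fun x t => B.matrix x t * max (symValue c A x t - α t) 0),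
    Finset.sum_comm (f := fun x t => A.matrix x t * max (symValue c A x t - α t) 0),
    Finset.sum_comm (f := fun x t => A.matrix x t * symValue c A x t)] at h3
  linarith

/-- In the initial round one of at least two boxes is visited with probability at most 1/2. It is
not saturated, so its value is a lower bound for the threshold. -/
theorem le_sum_matrix_mul_symValue {A : Strategy c.M c.T} {η : ℝ} {α : Fin c.T → ℝ}
    (hη : 0 ≤ η) (hM : 2 ≤ c.M)
    (hA : ∀ t, IsRound (c.k - 1) c.coeff c.f (A.unvisited t) (fun x => A.matrix x t) η (α t)) :
    c.f c.lastBox * (1 / 2) ^ (c.k - 1)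
      ≤ ∑ t, ∑ x, A.matrix x t * symValue c A x t + c.T * c.M * η := by
  let t : Fin c.T := ⟨0, c.T_pos⟩
  have hw : ∀ x, A.unvisited t x = 1 := by
    intro x
    rw [Strategy.unvisited, Finset.filter_false_of_mem, Finset.sum_empty, sub_zero]
    exact fun s _ hs => absurd hs (Nat.not_lt_zero _)
  obtain ⟨x, hx⟩ : ∃ x, A.matrix x t ≤ 1 / 2 := by
    by_contra! h
    have h1 := (hA t).sum_le
    have h2 : ∑ _x : Fin c.M, (1 / 2 : ℝ) < ∑ x, A.matrix x t :=
      Finset.sum_lt_sum_of_nonempty ⟨c.lastBox, Finset.mem_univ _⟩ fun x _ => h x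
    rw [Finset.sum_const, Finset.card_univ, Fintype.card_fin, nsmul_eq_mul] at h2
    have h3 : (2 : ℝ) ≤ c.M := by exact_mod_cast hM
    linarith
  have h1 := (hA t).upper x (by rw [hw]; linarith)
  rw [← A.notVisited_eq] at h1
  have h2 := (pow_le_symValue A x t).trans h1
  have h3 : c.f c.lastBox * (1 / 2) ^ (c.k - 1) ≤ c.f x * A.notVisited x t ^ (c.k - 1) := by
    refine mul_le_mul (c.f_anti x _ (Nat.le_sub_one_of_lt x.2)) ?_ (by positivity) (c.f_pos x).le
    refine pow_le_pow_left₀ (by norm_num) ?_ _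
    rw [A.notVisited_eq, hw]
    linarith
  have h4 : α t ≤ ∑ t, α t :=
    Finset.single_le_sum (f := α) (fun s _ => (hA s).threshold_nonneg) (Finset.mem_univ t)
  have h5 : 0 ≤ ∑ t, ∑ x, A.matrix x t * max (symValue c A x t - α t) 0 :=
    Finset.sum_nonneg fun t _ => Finset.sum_nonneg fun x _ =>
      mul_nonneg (A.matrix_nonneg x t) (le_max_right _ _)
  linarith [sum_threshold_le hη hA]

/-- A strategy whose rounds are `η`-equilibria is an approximate equilibrium of the game, if `η` is
small enough, or zero in the case of a single box. -/
theorem isSymmetricApproxEquilibrium_of_isRound {A : Strategy c.M c.T} {η θ : ℝ}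
    (hη : 0 ≤ η) (hθ : 0 < θ)
    (hA : ∀ t, ∃ α,
      IsRound (c.k - 1) c.coeff c.f (A.unvisited t) (fun x => A.matrix x t) η α)
    (h : (c.M = 1 ∧ η = 0) ∨ (2 ≤ c.M ∧
      2 * (c.T * c.M * η) ≤ c.f c.lastBox * (1 / 2) ^ (c.k - 1) ∧
      2 * (c.T * c.M * η) ≤ θ * (c.f c.lastBox * (1 / 2) ^ (c.k - 1)))) :
    IsSymmetricApproxEquilibrium c ((1 + c.C c.k) * (1 + θ)) A := by
  choose α hα using hA
  intro i B
  simp only [utility, value_symmetric]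
  change ∑ t, ∑ x, B.matrix x t * symValue c A x t
    ≤ _ * ∑ t, ∑ x, A.matrix x t * symValue c A x t
  have h1 := sum_matrix_mul_symValue_le hη hα B
  have h2 : 0 ≤ ∑ t, ∑ x, A.matrix x t * symValue c A x t :=
    Finset.sum_nonneg fun t _ => Finset.sum_nonneg fun x _ =>
      mul_nonneg (A.matrix_nonneg x t) (symValue_nonneg A x t)
  have h3 := c.C_last_nonneg
  have h5 : c.T * c.M * η ≤ θ * ∑ t, ∑ x, A.matrix x t * symValue c A x t := by
    rcases h with ⟨_, rfl⟩ | ⟨hM, h6, h7⟩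
    · rw [mul_zero]
      exact mul_nonneg hθ.le h2
    -- With `L` the lower bound in `h8`, `h6` makes the utility at least `L / 2`, and `h7` makes the
    -- error at most `θ * L / 2`.
    · have h8 := le_sum_matrix_mul_symValue hη hM hα
      nlinarith
  nlinarith [mul_nonneg h3 (mul_nonneg hθ.le h2)]

end Equilibrium

end SearchGame

namespace RealRAM

/-! ### Total correctness with a bound on the running time -/

/-- Started on `m`, the program `p` halts within `B` steps, on a memory that satisfies `Q`. -/
def Ends (p : Program) (m : Memory) (B : ℕ) (Q : Memory → Prop) : Prop :=
  ∃ n m', Runs p m n m' ∧ n ≤ B ∧ Q m'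

/-- The memory after writing `v` in register `r`. -/
def Memory.putNat (m : Memory) (r v : ℕ) : Memory :=
  { m with nat := Function.update m.nat r v }

/-- The memory after writing `v` in cell `i` of array `a`. -/
noncomputable def Memory.putReal (m : Memory) (a i : ℕ) (v : ℝ) : Memory :=
  { m with real := Function.update m.real a (Function.update (m.real a) i v) }

section Memory

variable (m : Memory) (a b i j r s v : ℕ) (u : ℝ)

@[simp] theorem Memory.putNat_real : (m.putNat r v).real = m.real := rfl

@[simp] theorem Memory.putReal_nat : (m.putReal a i u).nat = m.nat := rfl

@[simp] theorem Memory.putNat_nat_self : (m.putNat r v).nat r = v := by simp [Memory.putNat]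

@[simp] theorem Memory.putReal_real_self : (m.putReal a i u).real a i = u := by
  simp [Memory.putReal]

variable {b j s}

theorem Memory.putNat_nat_of_ne (h : s ≠ r) : (m.putNat r v).nat s = m.nat s := by
  simp [Memory.putNat, h]

theorem Memory.putReal_real_of_ne (h : b ≠ a) : (m.putReal a i u).real b = m.real b := by
  simp [Memory.putReal, h]

theorem Memory.putReal_real_of_cell_ne (h : j ≠ i) :
    (m.putReal a i u).real a j = m.real a j := by
  simp [Memory.putReal, h]

end Memory

/-- `m'` differs from `m` only in the registers `R` and the arrays `A`. -/
structure Frame (R A : List ℕ) (m m' : Memory) : Prop where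
  nat : ∀ r, r ∉ R → m'.nat r = m.nat r
  real : ∀ a, a ∉ A → m'.real a = m.real a

namespace Frame

variable {R R' A A' : List ℕ} {m m' m'' : Memory}

theorem refl : Frame R A m m := ⟨fun _ _ => rfl, fun _ _ => rfl⟩

theorem mono (h : Frame R' A' m m') (hR : R' ⊆ R) (hA : A' ⊆ A) : Frame R A m m' :=
  ⟨fun r hr => h.nat r fun h' => hr (hR h'), fun a ha => h.real a fun h' => ha (hA h')⟩

theorem trans (h : Frame R A m m') (h' : Frame R A m' m'') : Frame R A m m'' :=
  ⟨fun r hr => (h'.nat r hr).trans (h.nat r hr), fun a ha => (h'.real a ha).trans (h.real a ha)⟩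

theorem putNat (h : Frame R A m m') {r v : ℕ} (hr : r ∈ R) : Frame R A m (m'.putNat r v) :=
  h.trans ⟨fun s hs => m'.putNat_nat_of_ne r v (by rintro rfl; exact hs hr), fun _ _ => rfl⟩

theorem putReal (h : Frame R A m m') {a i : ℕ} {v : ℝ} (ha : a ∈ A) :
    Frame R A m (m'.putReal a i v) :=
  h.trans ⟨fun _ _ => rfl, fun b hb => m'.putReal_real_of_ne a i v (by rintro rfl; exact hb ha)⟩

end Frame

namespace Ends

variable {p q : Program} {m : Memory} {B B' : ℕ} {Q Q' : Memory → Prop}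

theorem mono (h : Ends p m B Q) (hB : B ≤ B') (hQ : ∀ m', Q m' → Q' m') : Ends p m B' Q' := by
  obtain ⟨n, m', h1, h2, h3⟩ := h
  exact ⟨n, m', h1, h2.trans hB, hQ m' h3⟩

theorem le (h : Ends p m B Q) (hB : B ≤ B') : Ends p m B' Q := h.mono hB fun _ => id

theorem setNat {r : ℕ} {e : NatExp} (h : Q (m.putNat r (e.eval m))) :
    Ends (.setNat r e) m (e.cost + 1) Q :=
  ⟨_, _, Runs.setNat r e m, le_rfl, h⟩

theorem setReal {a : ℕ} {i : NatExp} {u : RealExp} (h : Q (m.putReal a (i.eval m) (u.eval m))) :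
    Ends (.setReal a i u) m (i.cost + u.cost + 1) Q :=
  ⟨_, _, Runs.setReal a i u m, le_rfl, h⟩

theorem seq (h : Ends p m B Q) (h' : ∀ m', Q m' → Ends q m' B' Q') :
    Ends (.seq p q) m (B + B') Q' := by
  obtain ⟨n, m', h1, h2, h3⟩ := h
  obtain ⟨n', m'', h1', h2', h3'⟩ := h' m' h3
  exact ⟨_, m'', Runs.seq h1 h1', add_le_add h2 h2', h3'⟩

theorem setNat_seq {r : ℕ} {e : NatExp} (h : Ends q (m.putNat r (e.eval m)) B Q) :
    Ends (.seq (.setNat r e) q) m (e.cost + 1 + B) Q :=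
  seq (setNat (Q := fun m' => m' = m.putNat r (e.eval m)) rfl) fun _ hm => hm ▸ h

theorem setReal_seq {a : ℕ} {i : NatExp} {u : RealExp}
    (h : Ends q (m.putReal a (i.eval m) (u.eval m)) B Q) :
    Ends (.seq (.setReal a i u) q) m (i.cost + u.cost + 1 + B) Q :=
  seq (setReal (Q := fun m' => m' = m.putReal a (i.eval m) (u.eval m)) rfl) fun _ hm => hm ▸ h

theorem branch {b : Test} (h : b.Holds m → Ends p m B Q) (h' : ¬ b.Holds m → Ends q m B Q) :
    Ends (.branch b p q) m (b.cost + B + 1) Q := by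
  by_cases hb : b.Holds m
  · obtain ⟨n, m', h1, h2, h3⟩ := h hb
    exact ⟨_, m', Runs.branchTrue hb h1, by omega, h3⟩
  · obtain ⟨n, m', h1, h2, h3⟩ := h' hb
    exact ⟨_, m', Runs.branchFalse hb h1, by omega, h3⟩

end Ends

/-- `for r < e do p`. -/
def forLoop (r : ℕ) (e : NatExp) (p : Program) : Program :=
  .seq (.setNat r (.const 0))
    (.loop (.natLt (.reg r) e) (.seq p (.setNat r (.add (.reg r) (.const 1)))))

/-- The body may not write the counter (`hr`), and the invariant may not depend on it (`hI`). An
iteration adds at most 10 steps to the body: 5 for the test, 4 for the increment, 1 for the loop.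
The remaining 8 are the initialization and the failing test. -/
theorem Ends.forLoop {r : ℕ} {e : NatExp} {p : Program} {m : Memory} {n B : ℕ} {R A : List ℕ}
    {I : ℕ → Memory → Prop} (hr : r ∉ R) (hcost : e.cost ≤ 3)
    (he : ∀ m', Frame (r :: R) A m m' → e.eval m' = n)
    (hI : ∀ i m' v, I i m' → I i (m'.putNat r v)) (h0 : I 0 m)
    (hstep : ∀ i m', i < n → m'.nat r = i → Frame (r :: R) A m m' → I i m' →
      Ends p m' B fun m'' => Frame R A m' m'' ∧ I (i + 1) m'') :
    Ends (forLoop r e p) m (n * (B + 10) + 8) fun m' => Frame (r :: R) A m m' ∧ I n m' := by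
  have key : ∀ d i m', i + d = n → m'.nat r = i → Frame (r :: R) A m m' → I i m' →
      Ends (.loop (.natLt (.reg r) e) (.seq p (.setNat r (.add (.reg r) (.const 1))))) m'
        (d * (B + 10) + 6) fun m' => Frame (r :: R) A m m' ∧ I n m' := by
    intro d
    induction d with
    | zero =>
      intro i m' hi hm hF hI'
      refine ⟨_, m', Runs.loopFalse ?_, ?_, hF, ?_⟩
      · change ¬ (m'.nat r < e.eval m')
        rw [he m' hF]
        omega
      · simp only [Test.cost, NatExp.cost]
        omega
      · rwa [← hi, add_zero]
    | succ d ih =>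
      intro i m' hi hm hF hI'
      obtain ⟨k₁, m₁, h1, h2, h3, h4⟩ := hstep i m' (by omega) hm hF hI'
      have h5 : m₁.nat r = i := (h3.nat r hr).trans hm
      have h6 : Frame (r :: R) A m m₁ := hF.trans (h3.mono (by simp) (by simp))
      obtain ⟨k₂, m₂, h7, h8, h9⟩ := ih (i + 1) (m₁.putNat r (m₁.nat r + 1)) (by omega)
        (by rw [Memory.putNat_nat_self, h5]) (h6.putNat (by simp)) (hI _ _ _ h4)
      refine ⟨_, m₂, Runs.loopTrue ?_ (Runs.seq h1 (Runs.setNat _ _ _)) h7, ?_, h9⟩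
      · change m'.nat r < e.eval m'
        rw [he m' hF]
        omega
      · simp only [Test.cost, NatExp.cost]
        rw [Nat.succ_mul]
        omega
  refine (Ends.setNat_seq (key n 0 (m.putNat r 0) (by omega) (by simp)
    (Frame.refl.putNat (by simp)) (hI _ _ _ h0))).le ?_
  simp only [NatExp.cost]
  omega

/-- A bound for the running time of a loop. -/
theorem loop_cost_le {n X c d e : ℕ} (hX : 1 ≤ X) :
    n * (c * X + d) + e ≤ (c + d + e) * (X * (n + 1)) := by
  have h1 : n * d ≤ n * X * d := Nat.mul_le_mul_right d (Nat.le_mul_of_pos_right n hX)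
  have h2 : e ≤ X * e := Nat.le_mul_of_pos_left e hX
  nlinarith [Nat.zero_le (n * X * e), Nat.zero_le (X * d), Nat.zero_le (X * c)]

end RealRAM

namespace SearchGame

/-! ### Responses of a single box to a threshold -/

/-- `a` is, up to the error `η`, the probability with which a box of probability `f` that is
unvisited with probability `w` is visited in response to the threshold `α`. -/
structure IsResponse (n : ℕ) (b : ℕ → ℝ) (f w η α a : ℝ) : Prop where
  nonneg : 0 ≤ a
  le : a ≤ w
  lower : a * (α - f * bern n b a (w - a)) ≤ η
  upper : a < w → f * bern n b a (w - a) ≤ α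

section Response

variable {n : ℕ} {b : ℕ → ℝ} {f w η α a : ℝ}

/-- The state of the bisection for a response after `i` steps. -/
structure IsBracket (n : ℕ) (b : ℕ → ℝ) (f w α : ℝ) (i : ℕ) (lo hi : ℝ) : Prop where
  nonneg : 0 ≤ lo
  le : hi ≤ w
  sub_eq : hi - lo = w / 2 ^ i
  lower : lo = 0 ∨ α ≤ f * bern n b lo (w - lo)
  upper : hi = w ∨ f * bern n b hi (w - hi) < α

theorem IsBracket.start (n : ℕ) (b : ℕ → ℝ) (f w α : ℝ) : IsBracket n b f w α 0 0 w :=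
  ⟨le_rfl, le_rfl, by simp, Or.inl rfl, Or.inl rfl⟩

variable {i : ℕ} {lo hi : ℝ}

theorem IsBracket.step_upper (h : IsBracket n b f w α i lo hi) (hw : 0 ≤ w)
    (hm : f * bern n b ((lo + hi) / 2) (w - (lo + hi) / 2) < α) :
    IsBracket n b f w α (i + 1) lo ((lo + hi) / 2) := by
  have h1 : 0 ≤ w / 2 ^ i := by positivity
  have h2 := h.sub_eq
  refine ⟨h.nonneg, by linarith [h.le], ?_, h.lower, Or.inr hm⟩
  rw [pow_succ, ← div_div, ← h2]
  ring

theorem IsBracket.step_lower (h : IsBracket n b f w α i lo hi) (hw : 0 ≤ w)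
    (hm : ¬ f * bern n b ((lo + hi) / 2) (w - (lo + hi) / 2) < α) :
    IsBracket n b f w α (i + 1) ((lo + hi) / 2) hi := by
  have h1 : 0 ≤ w / 2 ^ i := by positivity
  have h2 := h.sub_eq
  refine ⟨by linarith [h.nonneg], h.le, ?_, Or.inr (not_lt.1 hm), h.upper⟩
  rw [pow_succ, ← div_div, ← h2]
  ring

/-- The upper end is the answer, so `upper` holds without error. For `lower`: if `lo = 0`, then `hi
≤ 2⁻ⁱ` and the deficit is at most 2; otherwise the value at `hi` is within `n * 2⁻ⁱ` of the value at
`lo`, which is at least `α`. -/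
theorem IsBracket.isResponse (h : IsBracket n b f w α i lo hi) (hb0 : ∀ ℓ, 0 ≤ b ℓ)
    (hb1 : ∀ ℓ, b ℓ ≤ 1) (hf0 : 0 ≤ f) (hf1 : f ≤ 1) (hw : 0 ≤ w) (hw1 : w ≤ 1) (hα : α ≤ 2) :
    IsResponse n b f w ((n + 2) / 2 ^ i) α hi := by
  have h0 : hi - lo ≤ 1 / 2 ^ i := by
    rw [h.sub_eq]
    gcongr
  have h1 : 0 ≤ hi - lo := by
    rw [h.sub_eq]
    positivity
  have hlo := h.nonneg
  have hhi : 0 ≤ hi := by linarith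
  have hhi1 : hi ≤ 1 := h.le.trans hw1
  have hη : ((n : ℝ) + 2) / 2 ^ i = (n + 2) * (1 / 2 ^ i) := by ring
  have hn : (0 : ℝ) ≤ n := n.cast_nonneg
  have hbern : 0 ≤ bern n b hi (w - hi) := bern_nonneg hb0 hhi (sub_nonneg.2 h.le)
  refine ⟨hhi, h.le, ?_, fun h2 => ?_⟩
  · rw [hη]
    rcases h.lower with h2 | h2
    · rw [h2, sub_zero] at h0
      have h3 : hi * (α - f * bern n b hi (w - hi)) ≤ hi * 2 :=
        mul_le_mul_of_nonneg_left (by linarith [mul_nonneg hf0 hbern]) hhi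
      have h4 : 0 ≤ n * (1 / 2 ^ i : ℝ) := by positivity
      linarith
    · have h3 := bern_lipschitz (n := n) hb0 hb1 hlo (sub_nonneg.1 h1) h.le hw1
      have h4 := mul_le_mul_of_nonneg_left h3 hf0
      have h6 : n * (hi - lo) ≤ n * (1 / 2 ^ i) := mul_le_mul_of_nonneg_left h0 hn
      have h5 : f * (n * (hi - lo)) ≤ n * (hi - lo) :=
        mul_le_of_le_one_left (mul_nonneg hn h1) hf1
      have h7 : α - f * bern n b hi (w - hi) ≤ n * (1 / 2 ^ i) := by linarith
      have h8 : 0 ≤ (1 / 2 ^ i : ℝ) := by positivity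
      have h9 : 0 ≤ (n : ℝ) * (1 / 2 ^ i) := by positivity
      nlinarith [mul_le_mul_of_nonneg_left h7 hhi, mul_nonneg (sub_nonneg.2 hhi1) h9]
  · rcases h.upper with h3 | h3
    · exact absurd h3 h2.ne
    · exact h3.le

theorem isResponse_zero (hb1 : ∀ ℓ, b ℓ ≤ 1) (hf0 : 0 ≤ f) (hf1 : f ≤ 1) (hw : 0 ≤ w) (hw1 : w ≤ 1)
    (hα : 1 ≤ α) (hη : 0 ≤ η) : IsResponse n b f w η α 0 := by
  refine ⟨le_rfl, hw, by simpa using hη, fun _ => ?_⟩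
  have h := bern_le_pow (n := n) hb1 le_rfl (sub_nonneg.2 hw)
  rw [zero_add, sub_zero] at h
  rw [sub_zero]
  nlinarith [pow_le_one₀ (n := n) hw hw1]

theorem isResponse_saturated (hb0 : ∀ ℓ, 0 ≤ b ℓ) (hf0 : 0 ≤ f) (hw : 0 ≤ w) (hη : 0 ≤ η) :
    IsResponse n b f w η 0 w := by
  refine ⟨hw, le_rfl, ?_, fun h => absurd h (lt_irrefl w)⟩
  have := mul_nonneg hw (mul_nonneg hf0 (bern_nonneg (n := n) hb0 hw (sub_self w).ge))
  linarith

/-- A number between the responses to two thresholds that are close is a response. -/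
theorem IsResponse.between {α' a' δ y : ℝ} (h : IsResponse n b f w η α a)
    (h' : IsResponse n b f w η α' a') (hb : Antitone b) (hf0 : 0 ≤ f) (hw1 : w ≤ 1)
    (hη : 0 ≤ η) (hα : α ≤ α') (hδ : α' ≤ α + δ) (hy : min a a' ≤ y) (hy' : y ≤ max a a') :
    IsResponse n b f w (η + δ) α' y := by
  have h0 : 0 ≤ y := (le_min h.nonneg h'.nonneg).trans hy
  have hyw : y ≤ w := hy'.trans (max_le h.le h'.le)
  refine ⟨h0, hyw, ?_, fun hlt => ?_⟩
  · have key : ∀ z β, y ≤ z → z ≤ w → α ≤ β → z * (β - f * bern n b z (w - z)) ≤ η →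
        y * (α' - f * bern n b y (w - y)) ≤ η + δ := by
      intro z β hyz hzw hβ hz
      have h1 := mul_le_mul_of_nonneg_left (bern_antitone (n := n) hb h0 hyz hzw) hf0
      have h2 : y * (α' - f * bern n b y (w - y)) ≤ y * (β - f * bern n b z (w - z)) + y * δ := by
        rw [← mul_add]
        exact mul_le_mul_of_nonneg_left (by linarith) h0
      have h3 : y * δ ≤ δ := mul_le_of_le_one_left (by linarith) (hyw.trans hw1)
      rcases le_total 0 (β - f * bern n b z (w - z)) with h4 | h4
      · nlinarith [mul_le_mul_of_nonneg_right hyz h4]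
      · nlinarith [mul_nonneg h0 (neg_nonneg.2 h4)]
    rcases max_choice a a' with h1 | h1 <;> rw [h1] at hy'
    · exact key a α hy' h.le le_rfl h.lower
    · exact key a' α' hy' h'.le hα h'.lower
  -- Here the comparison is with the smaller response, which is unsaturated because `y` is.
  · have key : ∀ z β, 0 ≤ z → z ≤ y → β ≤ α' → (z < w → f * bern n b z (w - z) ≤ β) →
        f * bern n b y (w - y) ≤ α' := fun z β hz hzy hβ hu =>
      (mul_le_mul_of_nonneg_left (bern_antitone hb hz hzy hyw) hf0).trans
        ((hu (hzy.trans_lt hlt)).trans hβ)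
    rcases min_choice a a' with h1 | h1 <;> rw [h1] at hy
    · exact key a α h.nonneg hy hα h.upper
    · exact key a' α' h'.nonneg hy le_rfl h'.upper

end Response

/-! ### The interpolation of two responses -/

section Interpolation

variable {M n : ℕ} {b : ℕ → ℝ} {f w a a' : Fin M → ℝ} {η δ α α' : ℝ}

theorem isRound_saturated (hb0 : ∀ ℓ, 0 ≤ b ℓ) (hf0 : ∀ x, 0 ≤ f x) (hw : ∀ x, 0 ≤ w x)
    (hsum : ∑ x, w x ≤ 1) (hη : 0 ≤ η) : IsRound n b f w w η 0 :=
  have h := fun x => isResponse_saturated (n := n) hb0 (hf0 x) (hw x) hη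
  ⟨hw, fun _ => le_rfl, hsum, le_rfl, by simp, fun x => (h x).lower, fun x => (h x).upper⟩

/-- The weight `r` lies in `[0, 1]` and is chosen to make the sum exactly 1. No order between `a x`
and `a' x` is needed. -/
theorem isRound_interpolation (h : ∀ x, IsResponse n b (f x) (w x) η α (a x))
    (h' : ∀ x, IsResponse n b (f x) (w x) η α' (a' x)) (hb : Antitone b) (hf0 : ∀ x, 0 ≤ f x)
    (hw1 : ∀ x, w x ≤ 1) (hη : 0 ≤ η) (hα0 : 0 ≤ α) (hα : α ≤ α') (hδ : α' ≤ α + δ)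
    (hs : 1 < ∑ x, a x) (hs' : ∑ x, a' x ≤ 1) :
    IsRound n b f w
      (fun x => a' x + (1 - ∑ x, a' x) / (∑ x, a x - ∑ x, a' x) * (a x - a' x)) (η + δ) α' := by
  set r := (1 - ∑ x, a' x) / (∑ x, a x - ∑ x, a' x) with hr
  have hden : 0 < ∑ x, a x - ∑ x, a' x := by linarith
  have hr0 : 0 ≤ r := div_nonneg (by linarith) hden.le
  have hr1 : r ≤ 1 := (div_le_one hden).2 (by linarith)
  have hres : ∀ x, IsResponse n b (f x) (w x) (η + δ) α' (a' x + r * (a x - a' x)) := by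
    intro x
    refine (h x).between (h' x) hb (hf0 x) (hw1 x) hη hα hδ ?_ ?_
    · rcases le_total (a x) (a' x) with h1 | h1
      · rw [min_eq_left h1]
        nlinarith
      · rw [min_eq_right h1]
        nlinarith
    · rcases le_total (a x) (a' x) with h1 | h1
      · rw [max_eq_right h1]
        nlinarith
      · rw [max_eq_left h1]
        nlinarith
  have hsum : ∑ x, (a' x + r * (a x - a' x)) = 1 := by
    rw [Finset.sum_add_distrib, ← Finset.mul_sum, Finset.sum_sub_distrib, hr,
      div_mul_cancel₀ _ hden.ne']
    ring
  exact ⟨fun x => (hres x).nonneg, fun x => (hres x).le, hsum.le, hα0.trans hα, by rw [hsum, mul_one],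
    fun x => (hres x).lower, fun x => (hres x).upper⟩

end Interpolation

end SearchGame

namespace SearchGame.Algorithm

open RealRAM

/-! ### The program

Registers: `3` number of bisection steps, `4` round, `5` step of the bisection for the threshold, `6`
box, `7` step of the bisection for a response, `8` and `9` indices in de Casteljau's recursion, `10`
position of the current column of the output.

Arrays: `4` probabilities of being unvisited, `5`, `6`, `7` responses to the lower, upper and middle
threshold, `8` work space of de Casteljau's recursion. Single numbers (cell `0`): `9`, `10`, `11`
lower, upper and middle threshold, `12`, `13`, `14` lower, upper and middle response of the current
box, `15`, `16`, `17` sums of the lower, upper and middle responses, `18` interpolation parameter,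
`19` counter for the precision. -/

/-- The number stored in cell `0` of an array. -/
def scalar (a : ℕ) : RealExp := .cell a (.const 0)

/-- `a := u`. -/
def setScalar (a : ℕ) (u : RealExp) : Program := .setReal a (.const 0) u

/-- The value of the polynomial in Bernstein form, into array `8`. -/
def evalProgram : Program :=
  .seq (forLoop 9 (.reg 0) (.setReal 8 (.reg 9) (.cell 1 (.add (.reg 9) (.const 1)))))
    (forLoop 8 (.sub (.reg 0) (.const 1))
      (forLoop 9 (.reg 0) (.setReal 8 (.reg 9)
        (.add (.mul (.sub (.cell 4 (.reg 6)) (scalar 14)) (.cell 8 (.reg 9)))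
          (.mul (scalar 14) (.cell 8 (.add (.reg 9) (.const 1))))))))

/-- The response of the current box to the middle threshold, into array `13`. -/
def responseProgram : Program :=
  .seq (setScalar 12 (.const 0))
    (.seq (setScalar 13 (.cell 4 (.reg 6)))
      (forLoop 7 (.reg 3)
        (.seq (setScalar 14 (.div (.add (scalar 12) (scalar 13)) (.const 2)))
          (.seq evalProgram
            (.branch (.realLt (.mul (.cell 2 (.reg 6)) (scalar 8)) (scalar 11))
              (setScalar 13 (scalar 14))
              (setScalar 12 (scalar 14)))))))

/-- The responses of all boxes to the middle threshold, and their sum. -/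
def responsesProgram : Program :=
  .seq (setScalar 17 (.const 0))
    (forLoop 6 (.reg 1)
      (.seq responseProgram
        (.seq (.setReal 7 (.reg 6) (scalar 13))
          (setScalar 17 (.add (scalar 17) (scalar 13))))))

/-- Copy the middle threshold, the responses to it and their sum. -/
def copyProgram (α s a : ℕ) : Program :=
  .seq (setScalar α (scalar 11))
    (.seq (setScalar s (scalar 17))
      (forLoop 6 (.reg 1) (.setReal a (.reg 6) (.cell 7 (.reg 6)))))

/-- The bisection for the threshold. -/
def thresholdProgram : Program :=
  forLoop 5 (.reg 3)
    (.seq (setScalar 11 (.div (.add (scalar 9) (scalar 10)) (.const 2)))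
      (.seq responsesProgram
        (.branch (.realLt (.const 1) (scalar 17)) (copyProgram 9 15 5) (copyProgram 10 16 6))))

/-- The start of the bisection for the threshold. -/
def initProgram : Program :=
  .seq (setScalar 9 (.const 0))
    (.seq (setScalar 10 (.const 2))
      (.seq (setScalar 15 (.const 0))
        (.seq (setScalar 16 (.const 0))
          (forLoop 6 (.reg 1)
            (.seq (.setReal 5 (.reg 6) (.cell 4 (.reg 6)))
              (.seq (.setReal 6 (.reg 6) (.const 0))
                (setScalar 15 (.add (scalar 15) (.cell 4 (.reg 6))))))))))

/-- The interpolation, which gives a column of the output. -/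
def finishProgram : Program :=
  .seq (.branch (.realLt (.const 1) (scalar 15))
      (setScalar 18 (.div (.sub (.const 1) (scalar 16)) (.sub (scalar 15) (scalar 16))))
      (setScalar 18 (.const 1)))
    (forLoop 6 (.reg 1)
      (.seq (.setReal 3 (.add (.reg 10) (.reg 6))
          (.add (.cell 6 (.reg 6)) (.mul (scalar 18) (.sub (.cell 5 (.reg 6)) (.cell 6 (.reg 6))))))
        (.setReal 4 (.reg 6)
          (.sub (.cell 4 (.reg 6)) (.cell 3 (.add (.reg 10) (.reg 6)))))))

/-- A round. -/
def roundProgram : Program :=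
  .seq initProgram
    (.seq thresholdProgram
      (.seq finishProgram (.setNat 10 (.add (.reg 10) (.reg 1)))))

/-- Double array `19` until it is at least `1`, and count the steps in register `3`. -/
def doublingProgram : Program :=
  .loop (.realLt (scalar 19) (.const 1))
    (.seq (setScalar 19 (.add (scalar 19) (scalar 19))) (.setNat 3 (.add (.reg 3) (.const 1))))

/-- `3 * (k + M + T) + 10`. -/
def baseSteps : NatExp :=
  .add (.add (.add (.add (.reg 0) (.reg 1)) (.reg 2))
    (.add (.add (.add (.reg 0) (.reg 1)) (.reg 2))
      (.add (.add (.reg 0) (.reg 1)) (.reg 2)))) (.const 10)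

/-- The number of bisection steps, into register `3`. -/
def precisionProgram : Program :=
  .seq (.setNat 3 baseSteps)
    (.seq (setScalar 19 (scalar 0))
      (.seq doublingProgram
        (.seq (setScalar 19 (.cell 2 (.sub (.reg 1) (.const 1)))) doublingProgram)))

/-- The algorithm. -/
def program : Program :=
  .seq precisionProgram
    (.seq (forLoop 6 (.reg 1) (.setReal 4 (.reg 6) (.const 1)))
      (forLoop 4 (.reg 2) roundProgram))

-- Correctness of the polynomial evaluation

attribute [simp] RealExp.eval NatExp.eval RealExp.cost NatExp.cost Test.cost Test.Holds

@[simp] theorem eval_scalar (a : ℕ) (m : Memory) : (scalar a).eval m = m.real a 0 := rfl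

@[simp] theorem cost_scalar (a : ℕ) : (scalar a).cost = 2 := rfl

theorem eval_reg_of_frame {m m' : Memory} {R A : List ℕ} (h : Frame R A m m') {r : ℕ} (hr : r ∉ R) :
    (NatExp.reg r).eval m' = m.nat r :=
  h.nat r hr

/-- De Casteljau's triangle is computed in place: after `p` passes, cell `ℓ` holds the polynomial of
degree `p` with coefficients from `ℓ` on, for `ℓ + p < k`. Cells beyond that range hold irrelevant
numbers. -/
theorem evalProgram_ends (m : Memory) (h0 : 0 < m.nat 0) :
    Ends evalProgram m (40 * (m.nat 0 + 1) ^ 2) fun m' => Frame [8, 9] [8] m m' ∧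
      m'.real 8 0 = bern (m.nat 0 - 1) (fun ℓ => m.real 1 (ℓ + 1)) (m.real 14 0)
        (m.real 4 (m.nat 6) - m.real 14 0) := by
  set k := m.nat 0 with hk
  set a := m.real 14 0 with ha
  set b := m.real 4 (m.nat 6) - a with hb
  have h1 : Ends (forLoop 9 (.reg 0) (.setReal 8 (.reg 9) (.cell 1 (.add (.reg 9) (.const 1))))) m
      (k * (6 + 10) + 8) fun m' => Frame [9] [8] m m' ∧
        ∀ ℓ < k, m'.real 8 ℓ = m.real 1 (ℓ + 1) := by
    refine Ends.forLoop (R := []) (I := fun i m' => ∀ ℓ < i, m'.real 8 ℓ = m.real 1 (ℓ + 1))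
      (by simp) (by simp) (fun m' hF => eval_reg_of_frame hF (by simp)) (fun i m' v h => h)
      (fun ℓ h => absurd h (Nat.not_lt_zero ℓ)) ?_
    intro i m' _ hi hF hI
    refine Ends.setReal ⟨Frame.refl.putReal (by simp), fun ℓ hℓ => ?_⟩
    simp only [NatExp.eval, RealExp.eval, hi]
    rcases Nat.lt_succ_iff_lt_or_eq.1 hℓ with h | rfl
    · rw [Memory.putReal_real_of_cell_ne _ _ _ _ h.ne, hI ℓ h]
    · rw [Memory.putReal_real_self, hF.real 1 (by simp)]
  refine ((h1.seq (B' := (k - 1) * (k * (18 + 10) + 8 + 10) + 8) fun m₁ h2 => ?_)).le ?_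
    (Q := fun m' => Frame [8, 9] [8] m m' ∧
      m'.real 8 0 = bern (k - 1) (fun ℓ => m.real 1 (ℓ + 1)) a b)
  · obtain ⟨hF1, hI1⟩ := h2
    have hk1 : m₁.nat 0 = k := hF1.nat 0 (by simp)
    refine (Ends.forLoop (R := [9]) (A := [8]) (I := fun i m' => ∀ ℓ, ℓ + i < k →
      m'.real 8 ℓ = bern i (fun j => m.real 1 (ℓ + j + 1)) a b) (n := k - 1)
      (by simp) (by simp) (fun m' hF => ?_) (fun i m' v h => h)
      (fun ℓ h => by simpa [bern] using hI1 ℓ h) ?_).mono le_rfl ?_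
    · simp [hF.nat 0, hk1]
    · intro p m₂ hp hp' hF2 hI2
      have hF12 : Frame [8, 9] [8] m m₂ := (hF1.mono (by simp) (by simp)).trans hF2
      have hk2 : m₂.nat 0 = k := hF12.nat 0 (by simp)
      -- Within a pass, cells before `i` are new and the others old, so the update of cell `i` still
      -- reads the old cell `i + 1`.
      refine (Ends.forLoop (R := []) (A := [8]) (I := fun i m' =>
          (∀ ℓ < i, ℓ + (p + 1) < k →
            m'.real 8 ℓ = bern (p + 1) (fun j => m.real 1 (ℓ + j + 1)) a b) ∧
          (∀ ℓ, i ≤ ℓ → ℓ + p < k →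
            m'.real 8 ℓ = bern p (fun j => m.real 1 (ℓ + j + 1)) a b)) (n := k)
        (by simp) (by simp) (fun m' hF => (eval_reg_of_frame hF (by simp)).trans hk2)
        (fun i m' v h => h) ⟨fun ℓ h => absurd h (Nat.not_lt_zero ℓ), fun ℓ _ => hI2 ℓ⟩ ?_).mono
          le_rfl fun m' h => ⟨h.1, fun ℓ hℓ => h.2.1 ℓ (by omega) hℓ⟩
      intro i m₃ _ hi hF3 hI3
      have hF13 : Frame [8, 9] [8] m m₃ := hF12.trans (hF3.mono (by simp) (by simp))
      refine Ends.setReal ⟨Frame.refl.putReal (by simp), fun ℓ hℓ hℓk => ?_, fun ℓ hℓ hℓk => ?_⟩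
      · simp only [NatExp.eval, RealExp.eval, hi, eval_scalar]
        rcases Nat.lt_succ_iff_lt_or_eq.1 hℓ with h | rfl
        · rw [Memory.putReal_real_of_cell_ne _ _ _ _ h.ne, hI3.1 ℓ h hℓk]
        · rw [Memory.putReal_real_self, hI3.2 ℓ le_rfl (by omega),
            hI3.2 (ℓ + 1) (Nat.le_succ ℓ) (by omega), hF13.real 4 (by simp),
            hF13.real 14 (by simp), hF13.nat 6 (by simp), bern]
          simp only [← ha, ← hb, Nat.add_right_comm ℓ 1, add_assoc]
      · simp only [NatExp.eval, hi]
        rw [Memory.putReal_real_of_cell_ne _ _ _ _ (by omega), hI3.2 ℓ (by omega) hℓk]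
    · intro m' h
      refine ⟨(hF1.mono (by simp) (by simp)).trans h.1, ?_⟩
      simpa using h.2 0 (by omega)
  · have h3 : (k - 1) * (k * (18 + 10) + 8 + 10) ≤ k * (k * (18 + 10) + 8 + 10) :=
      Nat.mul_le_mul_right _ (Nat.sub_le k 1)
    nlinarith

end SearchGame.Algorithm

namespace SearchGame.Algorithm

open RealRAM

/-! ### Correctness of the two nested bisections -/

/-- The data on which a round depends, with coefficients `b`, probabilities `f` and probabilities
`w` of being unvisited, are as they should be. -/
structure IsRoundData (M : ℕ) (b f w : ℕ → ℝ) : Prop where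
  coeff_nonneg : ∀ ℓ, 0 ≤ b ℓ
  coeff_le_one : ∀ ℓ, b ℓ ≤ 1
  antitone : Antitone b
  prob_nonneg : ∀ x < M, 0 ≤ f x
  prob_le_one : ∀ x < M, f x ≤ 1
  nonneg : ∀ x < M, 0 ≤ w x
  le_one : ∀ x < M, w x ≤ 1

/-- The polynomial coefficients in the memory. -/
def coeffs (m : Memory) (ℓ : ℕ) : ℝ := m.real 1 (ℓ + 1)

/-- The memory is ready for a round. -/
structure Ready (m : Memory) : Prop where
  pos : 0 < m.nat 0
  data : IsRoundData (m.nat 1) (coeffs m) (m.real 2) (m.real 4)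

theorem Ready.of_frame {m m' : Memory} {R A : List ℕ} (h : Ready m) (hF : Frame R A m m')
    (h0 : 0 ∉ R) (h1 : 1 ∉ R) (ha1 : 1 ∉ A) (ha2 : 2 ∉ A) (ha4 : 4 ∉ A) : Ready m' := by
  have hc : coeffs m' = coeffs m := by
    unfold coeffs
    rw [hF.real 1 ha1]
  refine ⟨(hF.nat 0 h0).symm ▸ h.pos, ?_⟩
  rw [hF.nat 1 h1, hc, hF.real 2 ha2, hF.real 4 ha4]
  exact h.data

/-- The error of a response. -/
noncomputable def responseError (m : Memory) : ℝ := ((m.nat 0 - 1 : ℕ) + 2) / 2 ^ m.nat 3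

theorem responseError_nonneg (m : Memory) : 0 ≤ responseError m := by
  unfold responseError
  positivity

/-- `a` is a response of box `x` to the threshold `α`. -/
def Responds (m : Memory) (x : ℕ) (α a : ℝ) : Prop :=
  IsResponse (m.nat 0 - 1) (coeffs m) (m.real 2 x) (m.real 4 x) (responseError m) α a

theorem responds_congr {m m' : Memory} {R A : List ℕ} (hF : Frame R A m m')
    (h0 : 0 ∉ R) (h3 : 3 ∉ R) (ha1 : 1 ∉ A) (ha2 : 2 ∉ A) (ha4 : 4 ∉ A) (x : ℕ) (α a : ℝ) :
    Responds m' x α a ↔ Responds m x α a := by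
  unfold Responds responseError coeffs
  rw [hF.nat 0 h0, hF.nat 3 h3, hF.real 1 ha1, hF.real 2 ha2, hF.real 4 ha4]

/-- A bound for the running time of `responseProgram`. -/
def responseCost (m : Memory) : ℕ := (m.nat 0 + 1) ^ 2 * (m.nat 3 + 1)

theorem responseProgram_ends (m : Memory) (hm : Ready m) (hx : m.nat 6 < m.nat 1)
    (hα : m.real 11 0 ≤ 2) :
    Ends responseProgram m (100 * responseCost m) fun m' =>
      Frame [7, 8, 9] [8, 12, 13, 14] m m' ∧ Responds m (m.nat 6) (m.real 11 0) (m'.real 13 0) := by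
  have hd := hm.data
  have hw0 := hd.nonneg _ hx
  refine Ends.mono (Ends.setReal_seq (Ends.setReal_seq (Ends.forLoop (R := [8, 9]) (A := [8, 12, 13, 14])
    (B := 9 + (40 * (m.nat 0 + 1) ^ 2 + 13)) (n := m.nat 3)
    (I := fun i m' => IsBracket (m.nat 0 - 1) (coeffs m) (m.real 2 (m.nat 6)) (m.real 4 (m.nat 6))
      (m.real 11 0) i (m'.real 12 0) (m'.real 13 0))
    (by simp) (by simp) (fun m' hF => eval_reg_of_frame hF (by simp)) (fun _ _ _ h => h) ?_ ?_)))
    ?_ ?_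
  · simp [Memory.putReal_real_of_ne, IsBracket.start]
  · intro i m₁ _ _ hF hI
    have hF1 : Frame [7, 8, 9] [8, 12, 13, 14] m m₁ := by
      refine Frame.trans ?_ hF
      exact (Frame.refl.putReal (by simp)).putReal (by simp)
    refine Ends.setReal_seq ?_
    simp only [NatExp.eval, RealExp.eval, eval_scalar]
    set lo := m₁.real 12 0
    set hi := m₁.real 13 0
    set m₂ := m₁.putReal 14 0 ((lo + hi) / (2 : ℚ)) with hm2
    have hF2 : Frame [7, 8, 9] [8, 12, 13, 14] m m₂ := hF1.putReal (by simp)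
    have h20 : m₂.nat 0 = m.nat 0 := hF2.nat 0 (by simp)
    have hE := evalProgram_ends m₂ (h20 ▸ hm.pos)
    rw [h20] at hE
    refine hE.seq fun m₃ h3 => ?_
    obtain ⟨hF3, h3⟩ := h3
    have hmid : m₂.real 14 0 = (lo + hi) / 2 := by simp [hm2]
    have h312 : m₃.real 12 0 = lo := by
      rw [hF3.real 12 (by simp), hm2, Memory.putReal_real_of_ne _ _ _ _ (by simp)]
    have h313 : m₃.real 13 0 = hi := by
      rw [hF3.real 13 (by simp), hm2, Memory.putReal_real_of_ne _ _ _ _ (by simp)]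
    have h314 : m₃.real 14 0 = (lo + hi) / 2 := by
      rw [hF3.real 14 (by simp), hmid]
    have hF13 : Frame [8, 9] [8, 12, 13, 14] m₁ m₃ :=
      (Frame.refl.putReal (by simp)).trans (hF3.mono (by simp) (by simp))
    have hF03 : Frame [7, 8, 9] [8, 12, 13, 14] m m₃ := hF1.trans (hF13.mono (by simp) (by simp))
    rw [hF2.real 1 (by simp), hF2.real 4 (by simp), hF2.nat 6 (by simp), hmid] at h3
    have htest : (Test.realLt (.mul (.cell 2 (.reg 6)) (scalar 8)) (scalar 11)).Holds m₃ ↔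
        m.real 2 (m.nat 6) * bern (m.nat 0 - 1) (coeffs m) ((lo + hi) / 2)
          (m.real 4 (m.nat 6) - (lo + hi) / 2) < m.real 11 0 := by
      simp only [Test.Holds, RealExp.eval, NatExp.eval, eval_scalar, h3, hF03.real 2 (by simp),
        hF03.nat 6 (by simp), hF03.real 11 (by simp)]
      rfl
    refine Ends.branch (B := 4) (fun hb => ?_) (fun hb => ?_) <;> rw [htest] at hb
    · refine Ends.setReal ⟨hF13.putReal (by simp), ?_⟩
      simp only [NatExp.eval, eval_scalar, h314, Memory.putReal_real_self,
        Memory.putReal_real_of_ne _ _ _ _ (show 12 ≠ 13 by simp), h312]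
      exact hI.step_upper hw0 hb
    · refine Ends.setReal ⟨hF13.putReal (by simp), ?_⟩
      simp only [NatExp.eval, eval_scalar, h314, Memory.putReal_real_self,
        Memory.putReal_real_of_ne _ _ _ _ (show 13 ≠ 12 by simp), h313]
      exact hI.step_lower hw0 hb
  · have := loop_cost_le (n := m.nat 3) (c := 40) (d := 32) (e := 15) (X := (m.nat 0 + 1) ^ 2)
      (Nat.one_le_pow _ _ (Nat.succ_pos _))
    unfold responseCost
    simp only [NatExp.cost, RealExp.cost]
    nlinarith
  · intro m' h
    exact ⟨Frame.trans ((Frame.refl.putReal (by simp)).putReal (by simp)) h.1, h.2.isResponse hd.coeff_nonneg hd.coeff_le_one (hd.prob_nonneg _ hx)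
      (hd.prob_le_one _ hx) hw0 (hd.le_one _ hx) hα⟩

theorem responseCost_congr {m m' : Memory} {R A : List ℕ} (hF : Frame R A m m')
    (h0 : 0 ∉ R) (h3 : 3 ∉ R) : responseCost m' = responseCost m := by
  unfold responseCost
  rw [hF.nat 0 h0, hF.nat 3 h3]

/-- A bound for the running time of `responsesProgram`. -/
def responsesCost (m : Memory) : ℕ := responseCost m * (m.nat 1 + 1)

theorem responseCost_pos (m : Memory) : 1 ≤ responseCost m := by
  unfold responseCost
  exact Nat.succ_le_of_lt (by positivity)

theorem responsesProgram_ends (m : Memory) (hm : Ready m) (hα : m.real 11 0 ≤ 2) :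
    Ends responsesProgram m (140 * responsesCost m) fun m' =>
      Frame [6, 7, 8, 9] [7, 8, 12, 13, 14, 17] m m' ∧
        (∀ x < m.nat 1, Responds m x (m.real 11 0) (m'.real 7 x)) ∧
        m'.real 17 0 = ∑ x ∈ Finset.range (m.nat 1), m'.real 7 x := by
  refine Ends.mono (Ends.setReal_seq (Ends.forLoop (R := [7, 8, 9]) (A := [7, 8, 12, 13, 14, 17])
    (B := 100 * responseCost m + (4 + 7)) (n := m.nat 1)
    (I := fun i m' => (∀ x < i, Responds m x (m.real 11 0) (m'.real 7 x)) ∧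
        m'.real 17 0 = ∑ x ∈ Finset.range i, m'.real 7 x)
    (by simp) (by simp) (fun m' hF => eval_reg_of_frame hF (by simp)) (fun _ _ _ h => h) ?_ ?_))
    ?_ fun m' h => ⟨(Frame.refl.putReal (by simp)).trans h.1, h.2⟩
  · simp
  · intro x m₁ hx hx6 hF hI
    have hF1 : Frame [6, 7, 8, 9] [7, 8, 12, 13, 14, 17] m m₁ :=
      (Frame.refl.putReal (by simp)).trans hF
    have h111 : m₁.real 11 0 = m.real 11 0 := by rw [hF1.real 11 (by simp)]
    have hE := responseProgram_ends m₁ (hm.of_frame hF1 (by simp) (by simp) (by simp) (by simp)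
      (by simp)) (by rw [hx6, hF1.nat 1 (by simp)]; exact hx) (by rw [h111]; exact hα)
    rw [responseCost_congr hF1 (by simp) (by simp), hx6, h111] at hE
    refine hE.seq fun m₂ h2 => ?_
    obtain ⟨hF2, h2⟩ := h2
    rw [responds_congr hF1 (by simp) (by simp) (by simp) (by simp) (by simp)] at h2
    have hF2' : Frame [7, 8, 9] [7, 8, 12, 13, 14, 17] m₁ m₂ := hF2.mono (by simp) (by simp)
    have h26 : m₂.nat 6 = x := (hF2.nat 6 (by simp)).trans hx6
    have h27 : m₂.real 7 = m₁.real 7 := hF2.real 7 (by simp)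
    have h217 : m₂.real 17 = m₁.real 17 := hF2.real 17 (by simp)
    refine Ends.setReal_seq (Ends.setReal ⟨(hF2'.putReal (by simp)).putReal (by simp), ?_⟩)
    simp only [NatExp.eval, RealExp.eval, eval_scalar, h26, Memory.putReal_real_self,
      Memory.putReal_real_of_ne _ _ _ _ (show 7 ≠ 17 by simp),
      Memory.putReal_real_of_ne _ _ _ _ (show 13 ≠ 7 by simp),
      Memory.putReal_real_of_ne _ _ _ _ (show 17 ≠ 7 by simp)]
    refine ⟨fun y hy => ?_, ?_⟩
    · rcases Nat.lt_succ_iff_lt_or_eq.1 hy with h | rfl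
      · rw [Memory.putReal_real_of_cell_ne _ _ _ _ h.ne, h27]
        exact hI.1 y h
      · rw [Memory.putReal_real_self]
        exact h2
    · rw [Finset.sum_range_succ, Memory.putReal_real_self, h217, hI.2]
      congr 1
      refine Finset.sum_congr rfl fun y hy => ?_
      rw [Memory.putReal_real_of_cell_ne _ _ _ _ (Finset.mem_range.1 hy).ne, h27]
  · have := loop_cost_le (n := m.nat 1) (c := 100) (d := 21) (e := 11) (X := responseCost m)
      (responseCost_pos m)
    unfold responsesCost
    simp only [NatExp.cost, RealExp.cost, add_assoc, Nat.reduceAdd] at this ⊢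
    omega

theorem copyProgram_ends (m : Memory) {α s a : ℕ} (h17 : α ≠ 17) (h7 : α ≠ 7) (hs7 : s ≠ 7)
    (hαs : α ≠ s) (hαa : α ≠ a) (hsa : s ≠ a) (ha7 : a ≠ 7) :
    Ends (copyProgram α s a) m (14 * m.nat 1 + 16) fun m' => Frame [6] [α, s, a] m m' ∧
      m'.real α 0 = m.real 11 0 ∧ m'.real s 0 = m.real 17 0 ∧
      ∀ x < m.nat 1, m'.real a x = m.real 7 x := by
  have hF : Frame [] [α, s, a] m ((m.putReal α 0 (m.real 11 0)).putReal s 0 (m.real 17 0)) :=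
    (Frame.refl.putReal (by simp)).putReal (by simp)
  refine Ends.mono (Ends.setReal_seq (Ends.setReal_seq (Ends.forLoop (R := []) (A := [a]) (B := 4)
    (n := m.nat 1) (I := fun i m' => ∀ x < i, m'.real a x = m.real 7 x)
    (by simp) (by simp) (fun m' hF => eval_reg_of_frame hF (by simp)) (fun _ _ _ h => h) ?_ ?_)))
    ?_ ?_
  · simp
  · intro i m₁ _ hi hF1 hI
    refine Ends.setReal ⟨Frame.refl.putReal (by simp), fun x hx => ?_⟩
    simp only [NatExp.eval, RealExp.eval, hi]
    rcases Nat.lt_succ_iff_lt_or_eq.1 hx with h | rfl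
    · rw [Memory.putReal_real_of_cell_ne _ _ _ _ h.ne]
      exact hI x h
    · rw [Memory.putReal_real_self, hF1.real 7 (by simp [ha7.symm]),
        Memory.putReal_real_of_ne _ _ _ _ hs7.symm, Memory.putReal_real_of_ne _ _ _ _ h7.symm]
  · simp
    omega
  · intro m' h
    simp only [NatExp.eval, eval_scalar, Memory.putReal_real_of_ne _ _ _ _ h17.symm] at h
    refine ⟨(hF.mono (by simp) (by simp)).trans (h.1.mono (by simp) (by simp)), ?_, ?_, h.2⟩
    · rw [h.1.real α (by simpa using hαa), Memory.putReal_real_of_ne _ _ _ _ hαs,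
        Memory.putReal_real_self]
    · rw [h.1.real s (by simpa using hsa), Memory.putReal_real_self]

/-- The state of the bisection for the threshold after `i` steps; `m` is a memory that holds the data
of the round. -/
structure IsSearchState (m : Memory) (i : ℕ) (m' : Memory) : Prop where
  nonneg : 0 ≤ m'.real 9 0
  le : m'.real 10 0 ≤ 2
  sub_eq : m'.real 10 0 - m'.real 9 0 = 2 / 2 ^ i
  lower : ∀ x < m.nat 1, Responds m x (m'.real 9 0) (m'.real 5 x)
  upper : ∀ x < m.nat 1, Responds m x (m'.real 10 0) (m'.real 6 x)
  lower_sum : m'.real 15 0 = ∑ x ∈ Finset.range (m.nat 1), m'.real 5 x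
  upper_sum : m'.real 16 0 = ∑ x ∈ Finset.range (m.nat 1), m'.real 6 x
  upper_le : m'.real 16 0 ≤ 1
  -- The second alternative is the initial state; it is given up only for a middle threshold whose
  -- responses sum to more than 1.
  lower_gt : 1 < m'.real 15 0 ∨ ∀ x < m.nat 1, m'.real 5 x = m.real 4 x

/-- A bound for the running time of `thresholdProgram`. -/
def thresholdCost (m : Memory) : ℕ := responsesCost m * (m.nat 3 + 1)

theorem le_responsesCost (m : Memory) : m.nat 1 + 1 ≤ responsesCost m :=
  Nat.le_mul_of_pos_left _ (responseCost_pos m)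

/-- The test on the middle sum preserves the conditions on both ends whatever its outcome, so the
computed sums need not be monotone in the threshold. -/
theorem thresholdProgram_ends (m : Memory) (hm : Ready m) (h0 : IsSearchState m 0 m) :
    Ends thresholdProgram m (220 * thresholdCost m) fun m' =>
      Frame [5, 6, 7, 8, 9] [5, 6, 7, 8, 9, 10, 11, 12, 13, 14, 15, 16, 17] m m' ∧
        IsSearchState m (m.nat 3) m' := by
  refine (Ends.forLoop (R := [6, 7, 8, 9])
    (A := [5, 6, 7, 8, 9, 10, 11, 12, 13, 14, 15, 16, 17])
    (B := 9 + (140 * responsesCost m + (4 + (14 * m.nat 1 + 16) + 1))) (n := m.nat 3)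
    (I := IsSearchState m)
    (by simp) (by simp) (fun m' hF => eval_reg_of_frame hF (by simp)) (fun _ _ _ h => ?_) h0 ?_).mono
    ?_ fun m' h => h
  · exact ⟨h.1, h.2, h.3, h.4, h.5, h.6, h.7, h.8, h.9⟩
  · intro i m₁ _ _ hF1 hI
    refine Ends.setReal_seq ?_
    simp only [NatExp.eval, RealExp.eval, eval_scalar]
    set lo := m₁.real 9 0 with hlo
    set hi := m₁.real 10 0 with hhi
    set m₂ := m₁.putReal 11 0 ((lo + hi) / (2 : ℚ)) with hm2
    have hmid : m₂.real 11 0 = (lo + hi) / 2 := by simp [hm2]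
    have hF12 : Frame [6, 7, 8, 9] [5, 6, 7, 8, 9, 10, 11, 12, 13, 14, 15, 16, 17] m₁ m₂ :=
      Frame.refl.putReal (by simp)
    have hF2 : Frame [5, 6, 7, 8, 9] [5, 6, 7, 8, 9, 10, 11, 12, 13, 14, 15, 16, 17] m m₂ :=
      hF1.trans (hF12.mono (by simp) (by simp))
    have hlohi : lo ≤ hi := by
      have h1 : (0 : ℝ) ≤ 2 / 2 ^ i := by positivity
      linarith [hI.sub_eq]
    have hsub := hI.sub_eq
    have hle := hI.le
    have hnonneg := hI.nonneg
    rw [← hlo, ← hhi] at hsub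
    rw [← hhi] at hle
    rw [← hlo] at hnonneg
    have hpow : (2 : ℝ) / 2 ^ (i + 1) = (2 / 2 ^ i) / 2 := by rw [pow_succ, div_div]
    have hE := responsesProgram_ends m₂ (hm.of_frame hF2 (by simp) (by simp) (by simp) (by simp)
      (by simp)) (by rw [hmid]; linarith)
    have hcost : responsesCost m₂ = responsesCost m := by
      unfold responsesCost
      rw [responseCost_congr hF2 (by simp) (by simp), hF2.nat 1 (by simp)]
    simp only [hcost, hF2.nat 1 (show 1 ∉ _ by simp), hmid,
      responds_congr hF2 (show 0 ∉ _ by simp) (show 3 ∉ _ by simp) (show 1 ∉ _ by simp)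
        (show 2 ∉ _ by simp) (show 4 ∉ _ by simp)] at hE
    refine hE.seq fun m₃ h3 => ?_
    obtain ⟨hF23, hres, hsum⟩ := h3
    have hF13 : Frame [6, 7, 8, 9] [5, 6, 7, 8, 9, 10, 11, 12, 13, 14, 15, 16, 17] m₁ m₃ :=
      hF12.trans (hF23.mono (by simp) (by simp))
    have hF13' : Frame [6, 7, 8, 9] [7, 8, 11, 12, 13, 14, 17] m₁ m₃ :=
      (Frame.refl.putReal (by simp)).trans (hF23.mono (by simp) (by simp))
    have h31 : m₃.nat 1 = m.nat 1 := (hF23.nat 1 (by simp)).trans (hF2.nat 1 (by simp))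
    have h311 : m₃.real 11 0 = (lo + hi) / 2 := by rw [hF23.real 11 (by simp), hmid]
    rw [← h31]
    refine Ends.branch (fun hb => ?_) (fun hb => ?_)
    · refine (copyProgram_ends m₃ (by simp) (by simp) (by simp) (by simp) (by simp) (by simp)
        (by simp)).mono le_rfl fun m₄ h4 => ⟨hF13.trans (h4.1.mono (by simp) (by simp)), ?_⟩
      obtain ⟨hF4, h9, h15, h5⟩ := h4
      rw [h31] at h5
      rw [h311] at h9
      have hF14 : Frame [6, 7, 8, 9] [7, 8, 11, 12, 13, 14, 17, 9, 15, 5] m₁ m₄ :=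
        (hF13'.mono (by simp) (by simp)).trans (hF4.mono (by simp) (by simp))
      have h10 : m₄.real 10 0 = hi := by rw [hF14.real 10 (by simp)]
      have h16 : m₄.real 16 = m₁.real 16 := hF14.real 16 (by simp)
      have h6 : m₄.real 6 = m₁.real 6 := hF14.real 6 (by simp)
      refine ⟨by rw [h9]; linarith, by rw [h10]; exact hle, ?_, fun x hx => ?_, fun x hx => ?_, ?_,
        ?_, by rw [h16]; exact hI.upper_le, Or.inl ?_⟩
      · rw [h9, h10, hpow, ← hsub]
        ring
      · rw [h9, h5 x hx]
        exact hres x hx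
      · rw [h10, h6]
        exact hI.upper x hx
      · rw [h15, hsum]
        exact Finset.sum_congr rfl fun x hx => (h5 x (Finset.mem_range.1 hx)).symm
      · rw [h16, h6]
        exact hI.upper_sum
      · rw [h15]
        simpa using hb
    · refine (copyProgram_ends m₃ (by simp) (by simp) (by simp) (by simp) (by simp) (by simp)
        (by simp)).mono le_rfl fun m₄ h4 => ⟨hF13.trans (h4.1.mono (by simp) (by simp)), ?_⟩
      obtain ⟨hF4, h10, h16, h6⟩ := h4
      rw [h31] at h6
      rw [h311] at h10
      have hF14 : Frame [6, 7, 8, 9] [7, 8, 11, 12, 13, 14, 17, 10, 16, 6] m₁ m₄ :=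
        (hF13'.mono (by simp) (by simp)).trans (hF4.mono (by simp) (by simp))
      have h9 : m₄.real 9 0 = lo := by rw [hF14.real 9 (by simp)]
      have h15 : m₄.real 15 = m₁.real 15 := hF14.real 15 (by simp)
      have h5 : m₄.real 5 = m₁.real 5 := hF14.real 5 (by simp)
      refine ⟨by rw [h9]; exact hnonneg, by rw [h10]; linarith, ?_, fun x hx => ?_, fun x hx => ?_,
        ?_, ?_, ?_, ?_⟩
      · rw [h9, h10, hpow, ← hsub]
        ring
      · rw [h9, h5]
        exact hI.lower x hx
      · rw [h10, h6 x hx]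
        exact hres x hx
      · rw [h15, h5]
        exact hI.lower_sum
      · rw [h16, hsum]
        exact Finset.sum_congr rfl fun x hx => (h6 x (Finset.mem_range.1 hx)).symm
      · rw [h16]
        simpa using hb
      · rw [h15, h5]
        exact hI.lower_gt
  · have h1 := le_responsesCost m
    have := loop_cost_le (n := m.nat 3) (c := 154) (d := 40) (e := 8) (X := responsesCost m)
      (by omega)
    have h2 : m.nat 3 * (9 + (140 * responsesCost m + (4 + (14 * m.nat 1 + 16) + 1)) + 10) + 8
        ≤ m.nat 3 * (154 * responsesCost m + 40) + 8 :=
      Nat.add_le_add_right (Nat.mul_le_mul_left _ (by omega)) 8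
    unfold thresholdCost
    omega

/-- The end thresholds have explicit responses: `w` to 0, and 0 to 2, because no value exceeds 1. -/
theorem initProgram_ends (m : Memory) (hm : Ready m) :
    Ends initProgram m (24 * (m.nat 1 + 1)) fun m' =>
      Frame [6] [5, 6, 9, 10, 15, 16] m m' ∧ IsSearchState m 0 m' := by
  have hd := hm.data
  refine Ends.mono (Ends.setReal_seq (Ends.setReal_seq (Ends.setReal_seq (Ends.setReal_seq
    (Ends.forLoop (R := []) (A := [5, 6, 15]) (B := 4 + (3 + 7)) (n := m.nat 1)
    (I := fun i m' => (∀ x < i, m'.real 5 x = m.real 4 x) ∧ (∀ x < i, m'.real 6 x = 0) ∧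
      m'.real 15 0 = ∑ x ∈ Finset.range i, m.real 4 x)
    (by simp) (by simp) (fun m' hF => eval_reg_of_frame hF (by simp)) (fun _ _ _ h => h)
    ?_ ?_))))) ?_ ?_
  · simp [Memory.putReal_real_of_ne]
  · intro i m₁ _ hi hF1 hI
    refine Ends.setReal_seq (Ends.setReal_seq (Ends.setReal
      ⟨((Frame.refl.putReal (by simp)).putReal (by simp)).putReal (by simp), ?_⟩))
    have h4 : m₁.real 4 = m.real 4 := by
      rw [hF1.real 4 (by simp)]
      simp [Memory.putReal_real_of_ne]
    simp only [NatExp.eval, RealExp.eval, eval_scalar, hi, Memory.putReal_nat,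
      Memory.putReal_real_self, h4,
      Memory.putReal_real_of_ne _ _ _ _ (show 5 ≠ 15 by simp),
      Memory.putReal_real_of_ne _ _ _ _ (show 6 ≠ 15 by simp),
      Memory.putReal_real_of_ne _ _ _ _ (show 5 ≠ 6 by simp),
      Memory.putReal_real_of_ne _ _ _ _ (show 15 ≠ 6 by simp),
      Memory.putReal_real_of_ne _ _ _ _ (show 15 ≠ 5 by simp),
      Memory.putReal_real_of_ne _ _ _ _ (show 4 ≠ 6 by simp),
      Memory.putReal_real_of_ne _ _ _ _ (show 4 ≠ 5 by simp)]
    refine ⟨fun x hx => ?_, fun x hx => ?_, by rw [Finset.sum_range_succ, hI.2.2]⟩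
    · rcases Nat.lt_succ_iff_lt_or_eq.1 hx with h | rfl
      · rw [Memory.putReal_real_of_cell_ne _ _ _ _ h.ne]
        exact hI.1 x h
      · rw [Memory.putReal_real_self]
    · rcases Nat.lt_succ_iff_lt_or_eq.1 hx with h | rfl
      · rw [Memory.putReal_real_of_cell_ne _ _ _ _ h.ne,
          Memory.putReal_real_of_ne _ _ _ _ (show 6 ≠ 5 by simp)]
        exact hI.2.1 x h
      · simp
  · simp
    omega
  · intro m' h
    obtain ⟨hF, h5, h6, h15⟩ := h
    have hF0 : Frame [6] [5, 6, 9, 10, 15, 16] m m' :=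
      ((((Frame.refl.putReal (by simp)).putReal (by simp)).putReal (by simp)).putReal (by simp)).trans
        (hF.mono (by simp) (by simp))
    have h9 : m'.real 9 0 = 0 := by
      rw [hF.real 9 (by simp)]
      simp [Memory.putReal_real_of_ne]
    have h10 : m'.real 10 0 = 2 := by
      rw [hF.real 10 (by simp)]
      simp [Memory.putReal_real_of_ne]
    have h16 : m'.real 16 0 = 0 := by
      rw [hF.real 16 (by simp)]
      simp
    refine ⟨hF0, h9.ge, h10.le, by simp [h9, h10], fun x hx => ?_, fun x hx => ?_, ?_, ?_,
      h16.le.trans zero_le_one, Or.inr h5⟩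
    · rw [h9, h5 x hx]
      exact isResponse_saturated hd.coeff_nonneg (hd.prob_nonneg x hx) (hd.nonneg x hx)
        (responseError_nonneg m)
    · rw [h10, h6 x hx]
      exact isResponse_zero hd.coeff_le_one (hd.prob_nonneg x hx) (hd.prob_le_one x hx)
        (hd.nonneg x hx) (hd.le_one x hx) one_le_two (responseError_nonneg m)
    · rw [h15]
      exact Finset.sum_congr rfl fun x hx => (h5 x (Finset.mem_range.1 hx)).symm
    · rw [h16, Finset.sum_eq_zero fun x hx => h6 x (Finset.mem_range.1 hx)]

end SearchGame.Algorithm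

namespace SearchGame.Algorithm

open RealRAM

/-! ### Correctness of a round -/

/-- The error of a round. -/
noncomputable def roundError (m : Memory) : ℝ := responseError m + 2 / 2 ^ m.nat 3

/-- The interpolation parameter. -/
noncomputable def interpolationParameter (m : Memory) : ℝ :=
  open Classical in
  if 1 < m.real 15 0 then (1 - m.real 16 0) / (m.real 15 0 - m.real 16 0) else 1

/-- The interpolated response of box `x`. -/
noncomputable def interpolation (m : Memory) (x : ℕ) : ℝ :=
  m.real 6 x + interpolationParameter m * (m.real 5 x - m.real 6 x)

open Classical in
-- Responses are at most `w`, so a lower sum above 1 forces the `w x` to sum to more than 1.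
-- Otherwise the lower responses are still `w`, the interpolation parameter 1 returns them, and the
-- round is exact. The zero error is what handles a single box.
theorem IsSearchState.isRound {m m' : Memory} (hm : Ready m) (h : IsSearchState m (m.nat 3) m') :
    ∃ α, IsRound (m.nat 0 - 1) (coeffs m) (fun x : Fin (m.nat 1) => m.real 2 x)
      (fun x => m.real 4 x) (fun x => interpolation m' x)
      (if 1 < ∑ x : Fin (m.nat 1), m.real 4 x then roundError m else 0) α := by
  have hd := hm.data
  have hlo := h.lower_sum
  have hhi := h.upper_sum
  rw [Finset.sum_range] at hlo hhi
  by_cases hgt : 1 < m'.real 15 0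
  · have hw : 1 < ∑ x : Fin (m.nat 1), m.real 4 x :=
      hgt.trans_le (hlo.trans_le (Finset.sum_le_sum fun x _ => (h.lower x x.2).le))
    rw [if_pos hw]
    have hsub := h.sub_eq
    have h2 : (0 : ℝ) ≤ 2 / 2 ^ m.nat 3 := by positivity
    have hle := h.upper_le
    refine ⟨m'.real 10 0, ?_⟩
    unfold interpolation interpolationParameter
    rw [if_pos hgt, hlo, hhi]
    rw [hlo] at hgt
    rw [hhi] at hle
    exact isRound_interpolation (fun x => h.lower x x.2) (fun x => h.upper x x.2) hd.antitone
      (fun x => hd.prob_nonneg x x.2) (fun x => hd.le_one x x.2) (responseError_nonneg m) h.nonneg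
      (by linarith) (by linarith) hgt hle
  · have h5 := h.lower_gt.resolve_left hgt
    have hw : ∑ x : Fin (m.nat 1), m.real 4 x ≤ 1 := by
      rw [Finset.sum_congr rfl fun x _ => (h5 x.val x.2).symm, ← hlo]
      exact not_lt.1 hgt
    rw [if_neg hw.not_gt]
    refine ⟨0, ?_⟩
    have ha : (fun x : Fin (m.nat 1) => interpolation m' x) = fun x : Fin (m.nat 1) => m.real 4 x := by
      funext x
      unfold interpolation interpolationParameter
      rw [if_neg hgt, h5 x x.2]
      ring
    rw [ha]
    exact isRound_saturated hd.coeff_nonneg (fun x => hd.prob_nonneg x x.2)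
      (fun x => hd.nonneg x x.2) hw le_rfl

theorem finishProgram_ends (m : Memory) :
    Ends finishProgram m (34 * m.nat 1 + 26) fun m' => Frame [6] [3, 4, 18] m m' ∧
      (∀ x < m.nat 1, m'.real 3 (m.nat 10 + x) = interpolation m x) ∧
      (∀ x < m.nat 1, m'.real 4 x = m.real 4 x - interpolation m x) ∧
      ∀ j < m.nat 10, m'.real 3 j = m.real 3 j := by
  have h1 : Ends (.branch (.realLt (.const 1) (scalar 15))
      (setScalar 18 (.div (.sub (.const 1) (scalar 16)) (.sub (scalar 15) (scalar 16))))
      (setScalar 18 (.const 1))) m (4 + 12 + 1)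
      fun m' => m' = m.putReal 18 0 (interpolationParameter m) := by
    refine Ends.branch (fun hb => ?_) (fun hb => ?_)
    · refine Ends.setReal ?_
      have hb' : 1 < m.real 15 0 := by simpa using hb
      rw [interpolationParameter, if_pos hb']
      simp
    · refine Ends.le (Ends.setReal ?_) (by simp)
      have hb' : ¬ 1 < m.real 15 0 := by simpa using hb
      rw [interpolationParameter, if_neg hb']
      simp
  refine Ends.mono (h1.seq (B' := m.nat 1 * (15 + 9 + 10) + 8) (Q' := fun m' => Frame [6] [3, 4]
      (m.putReal 18 0 (interpolationParameter m)) m' ∧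
      (∀ x < m.nat 1, m'.real 3 (m.nat 10 + x) = interpolation m x) ∧
      (∀ x < m.nat 1, m'.real 4 x = m.real 4 x - interpolation m x) ∧
      (∀ x, m.nat 1 ≤ x → m'.real 4 x = m.real 4 x) ∧
      ∀ j < m.nat 10, m'.real 3 j = m.real 3 j) fun m₁ h2 => ?_) ?_ ?_
  · subst h2
    refine Ends.forLoop (R := []) (A := [3, 4]) (B := 15 + 9) (n := m.nat 1)
      (I := fun i m' => (∀ x < i, m'.real 3 (m.nat 10 + x) = interpolation m x) ∧
        (∀ x < i, m'.real 4 x = m.real 4 x - interpolation m x) ∧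
        (∀ x, i ≤ x → m'.real 4 x = m.real 4 x) ∧ ∀ j < m.nat 10, m'.real 3 j = m.real 3 j)
      (by simp) (by simp) (fun m' hF => eval_reg_of_frame hF (by simp))
      (fun _ _ _ h => h) ?_ ?_
    · simp [Memory.putReal_real_of_ne]
    · intro i m₂ _ hi hF hI
      have h10 : m₂.nat 10 = m.nat 10 := hF.nat 10 (by simp)
      have h5 : m₂.real 5 = m.real 5 := by
        rw [hF.real 5 (by simp), Memory.putReal_real_of_ne _ _ _ _ (by simp)]
      have h6 : m₂.real 6 = m.real 6 := by
        rw [hF.real 6 (by simp), Memory.putReal_real_of_ne _ _ _ _ (by simp)]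
      have h18 : m₂.real 18 0 = interpolationParameter m := by
        rw [hF.real 18 (by simp), Memory.putReal_real_self]
      refine Ends.setReal_seq (Ends.setReal
        ⟨(Frame.refl.putReal (by simp)).putReal (by simp), ?_⟩)
      simp only [NatExp.eval, RealExp.eval, eval_scalar, hi, h10, h5, h6, h18, Memory.putReal_nat,
        Memory.putReal_real_self, Memory.putReal_real_of_ne _ _ _ _ (show 3 ≠ 4 by simp),
        Memory.putReal_real_of_ne _ _ _ _ (show 4 ≠ 3 by simp)]
      refine ⟨fun x hx => ?_, fun x hx => ?_, fun x hx => ?_, fun j hj => ?_⟩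
      · rcases Nat.lt_succ_iff_lt_or_eq.1 hx with h | rfl
        · rw [Memory.putReal_real_of_cell_ne _ _ _ _ (by omega)]
          exact hI.1 x h
        · rw [Memory.putReal_real_self]
          rfl
      · rcases Nat.lt_succ_iff_lt_or_eq.1 hx with h | rfl
        · rw [Memory.putReal_real_of_cell_ne _ _ _ _ h.ne,
            Memory.putReal_real_of_ne _ _ _ _ (by simp)]
          exact hI.2.1 x h
        · rw [Memory.putReal_real_self, hI.2.2.1 x le_rfl]
          rfl
      · rw [Memory.putReal_real_of_cell_ne _ _ _ _ (by omega),
          Memory.putReal_real_of_ne _ _ _ _ (by simp)]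
        exact hI.2.2.1 x (by omega)
      · rw [Memory.putReal_real_of_cell_ne _ _ _ _ (by omega)]
        exact hI.2.2.2 j hj
  · omega
  · rintro m' ⟨hF, h3, h4, -, h5⟩
    exact ⟨(Frame.refl.putReal (by simp)).trans (hF.mono (by simp) (by simp)), h3, h4, h5⟩

open Classical in
theorem roundProgram_ends (m : Memory) (hm : Ready m) :
    Ends roundProgram m (310 * thresholdCost m) fun m' =>
      Frame [5, 6, 7, 8, 9, 10] [3, 4, 5, 6, 7, 8, 9, 10, 11, 12, 13, 14, 15, 16, 17, 18] m m' ∧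
      m'.nat 10 = m.nat 10 + m.nat 1 ∧
      (∃ α, IsRound (m.nat 0 - 1) (coeffs m) (fun x : Fin (m.nat 1) => m.real 2 x)
        (fun x => m.real 4 x) (fun x => m'.real 3 (m.nat 10 + x))
        (if 1 < ∑ x : Fin (m.nat 1), m.real 4 x then roundError m else 0) α) ∧
      (∀ x < m.nat 1, m'.real 4 x = m.real 4 x - m'.real 3 (m.nat 10 + x)) ∧
      ∀ j < m.nat 10, m'.real 3 j = m.real 3 j := by
  refine Ends.le ((initProgram_ends m hm).seq fun m₁ h1 => Ends.seq (Ends.mono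
    (B' := 220 * thresholdCost m)
    (Q' := fun m₂ => Frame [5, 6, 7, 8, 9] [5, 6, 7, 8, 9, 10, 11, 12, 13, 14, 15, 16, 17] m m₂ ∧
      IsSearchState m (m.nat 3) m₂) (thresholdProgram_ends m₁ ?_ ?_) ?_ ?_) fun m₂ h2 => Ends.seq
        (Ends.le (B' := 34 * m.nat 1 + 26) (finishProgram_ends m₂) ?_) fun m₃ h3 =>
          Ends.setNat ?_) ?_
  · exact hm.of_frame h1.1 (by simp) (by simp) (by simp) (by simp) (by simp)
  · have hF := h1.1
    have h := h1.2
    have hc : ∀ x α a, Responds m₁ x α a ↔ Responds m x α a :=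
      responds_congr hF (by simp) (by simp) (by simp) (by simp) (by simp)
    refine ⟨h.1, h.2, h.3, ?_, ?_, ?_, ?_, h.8, ?_⟩
    · simpa only [hc, hF.nat 1 (show 1 ∉ _ by simp)] using h.4
    · simpa only [hc, hF.nat 1 (show 1 ∉ _ by simp)] using h.5
    · simpa only [hF.nat 1 (show 1 ∉ _ by simp)] using h.6
    · simpa only [hF.nat 1 (show 1 ∉ _ by simp)] using h.7
    · simpa only [hF.nat 1 (show 1 ∉ _ by simp), hF.real 4 (show 4 ∉ _ by simp)] using h.9
  · refine le_of_eq ?_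
    unfold thresholdCost responsesCost
    rw [responseCost_congr h1.1 (by simp) (by simp), h1.1.nat 1 (by simp), h1.1.nat 3 (by simp)]
  · rintro m' ⟨hF', h⟩
    have hF := h1.1
    refine ⟨(hF.mono (by simp) (by simp)).trans hF', h.1, h.2, ?_, ?_, ?_, ?_, ?_, h.8, ?_⟩
    · simpa only [hF.nat 3 (show 3 ∉ _ by simp)] using h.3
    · simpa only [responds_congr hF (show 0 ∉ _ by simp) (show 3 ∉ _ by simp) (show 1 ∉ _ by simp)
        (show 2 ∉ _ by simp) (show 4 ∉ _ by simp), hF.nat 1 (show 1 ∉ _ by simp)] using h.4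
    · simpa only [responds_congr hF (show 0 ∉ _ by simp) (show 3 ∉ _ by simp) (show 1 ∉ _ by simp)
        (show 2 ∉ _ by simp) (show 4 ∉ _ by simp), hF.nat 1 (show 1 ∉ _ by simp)] using h.5
    · simpa only [hF.nat 1 (show 1 ∉ _ by simp)] using h.6
    · simpa only [hF.nat 1 (show 1 ∉ _ by simp)] using h.7
    · simpa only [hF.nat 1 (show 1 ∉ _ by simp), hF.real 4 (show 4 ∉ _ by simp)] using h.9
  · rw [h2.1.nat 1 (by simp)]
  · obtain ⟨hF2, hS⟩ := h2
    obtain ⟨hF3, h33, h34, h35⟩ := h3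
    rw [hF2.nat 10 (by simp), hF2.nat 1 (by simp)] at h33
    rw [hF2.nat 1 (by simp), hF2.real 4 (by simp)] at h34
    rw [hF2.nat 10 (by simp), hF2.real 3 (by simp)] at h35
    have hF : Frame [5, 6, 7, 8, 9, 10] [3, 4, 5, 6, 7, 8, 9, 10, 11, 12, 13, 14, 15, 16, 17, 18]
      m m₃ := (hF2.mono (by simp) (by simp)).trans (hF3.mono (by simp) (by simp))
    refine ⟨hF.putNat (by simp), ?_, ?_, fun x hx => ?_, h35⟩
    · simp [hF3.nat 10, hF2.nat 10, hF3.nat 1, hF2.nat 1]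
    · have ha : (fun x : Fin (m.nat 1) =>
          (m₃.putNat 10 ((NatExp.add (.reg 10) (.reg 1)).eval m₃)).real 3 (m.nat 10 + x))
          = fun x : Fin (m.nat 1) => interpolation m₂ x := funext fun x => h33 x x.2
      rw [ha]
      exact hS.isRound hm
    · change m₃.real 4 x = m.real 4 x - m₃.real 3 (m.nat 10 + x)
      rw [h34 x hx, h33 x hx]
  · have h1 : m.nat 1 + 1 ≤ thresholdCost m :=
      (le_responsesCost m).trans (Nat.le_mul_of_pos_right _ (Nat.succ_pos _))
    simp only [NatExp.cost]
    omega

/-! ### The rounds -/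

/-- The probability that box `x` is not visited before round `t`, for the output `O`. -/
noncomputable def remaining (M : ℕ) (O : ℕ → ℝ) (t x : ℕ) : ℝ :=
  1 - ∑ s ∈ Finset.range t, O (s * M + x)

open Classical in
/-- In round `t` the output `O` is an equilibrium, up to the error `η`. -/
def IsRoundAt (M n : ℕ) (b f : ℕ → ℝ) (η : ℝ) (O : ℕ → ℝ) (t : ℕ) : Prop :=
  ∃ α, IsRound n b (fun x : Fin M => f x) (fun x => remaining M O t x) (fun x => O (t * M + x))
    (if 1 < ∑ x : Fin M, remaining M O t x then η else 0) α

theorem cell_lt {M s t x : ℕ} (hs : s < t) (hx : x < M) : s * M + x < t * M :=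
  calc s * M + x < (s + 1) * M := by rw [Nat.succ_mul]; omega
    _ ≤ t * M := Nat.mul_le_mul_right M hs

theorem remaining_congr {M t : ℕ} {O O' : ℕ → ℝ} (h : ∀ j < t * M, O' j = O j) {s x : ℕ}
    (hs : s ≤ t) (hx : x < M) : remaining M O' s x = remaining M O s x := by
  unfold remaining
  congr 1
  exact Finset.sum_congr rfl fun r hr => h _ (cell_lt ((Finset.mem_range.1 hr).trans_le hs) hx)

/-- Round `s` depends only on columns up to `s`, which later rounds leave alone. -/
theorem IsRoundAt.congr {M n t : ℕ} {b f : ℕ → ℝ} {η : ℝ} {O O' : ℕ → ℝ}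
    (h : ∀ j < t * M, O' j = O j) {s : ℕ} (hs : s < t) (hr : IsRoundAt M n b f η O s) :
    IsRoundAt M n b f η O' s := by
  have h1 : (fun x : Fin M => remaining M O' s x) = fun x : Fin M => remaining M O s x :=
    funext fun x => remaining_congr h hs.le x.2
  have h2 : (fun x : Fin M => O' (s * M + x)) = fun x : Fin M => O (s * M + x) :=
    funext fun x => h _ (cell_lt hs x.2)
  unfold IsRoundAt at hr ⊢
  rw [h1, h2]
  exact hr

/-- The state of the computation after `t` rounds. -/
structure IsRoundsState (m : Memory) (t : ℕ) (m' : Memory) : Prop where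
  column : m'.nat 10 = t * m.nat 1
  eq_remaining : ∀ x < m.nat 1, m'.real 4 x = remaining (m.nat 1) (m'.real 3) t x
  nonneg : ∀ x < m.nat 1, 0 ≤ m'.real 4 x
  le_one : ∀ x < m.nat 1, m'.real 4 x ≤ 1
  isRoundAt : ∀ s < t, IsRoundAt (m.nat 1) (m.nat 0 - 1) (coeffs m) (m.real 2) (roundError m)
    (m'.real 3) s

theorem rounds_ends (m : Memory) (hm : Ready m) (h0 : IsRoundsState m 0 m) :
    Ends (forLoop 4 (.reg 2) roundProgram) m (330 * (thresholdCost m * (m.nat 2 + 1))) fun m' =>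
      IsRoundsState m (m.nat 2) m' := by
  refine Ends.mono (Ends.forLoop (R := [5, 6, 7, 8, 9, 10])
    (A := [3, 4, 5, 6, 7, 8, 9, 10, 11, 12, 13, 14, 15, 16, 17, 18])
    (B := 310 * thresholdCost m) (n := m.nat 2) (I := IsRoundsState m)
    (by simp) (by simp) (fun m' hF => eval_reg_of_frame hF (by simp)) (fun t m' v h => ?_) h0 ?_) ?_
    fun m' h => h.2
  · refine ⟨?_, h.2, h.3, h.4, h.5⟩
    rw [Memory.putNat_nat_of_ne _ _ _ (by simp)]
    exact h.1
  · intro t m₁ ht ht' hF hI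
    have h11 : m₁.nat 1 = m.nat 1 := hF.nat 1 (by simp)
    have hc : coeffs m₁ = coeffs m := by
      unfold coeffs
      rw [hF.real 1 (by simp)]
    have hd := hm.data
    have hm1 : Ready m₁ := by
      refine ⟨by rw [hF.nat 0 (by simp)]; exact hm.pos, ?_⟩
      rw [h11, hc, hF.real 2 (by simp)]
      exact ⟨hd.1, hd.2, hd.3, hd.4, hd.5, hI.nonneg, hI.le_one⟩
    have hcost : thresholdCost m₁ = thresholdCost m := by
      unfold thresholdCost responsesCost
      rw [responseCost_congr hF (by simp) (by simp), h11, hF.nat 3 (by simp)]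
    have herr : roundError m₁ = roundError m := by
      unfold roundError responseError
      rw [hF.nat 0 (by simp), hF.nat 3 (by simp)]
    refine (roundProgram_ends m₁ hm1).mono (by rw [hcost]) fun m₂ h2 => ⟨h2.1, ?_⟩
    obtain ⟨-, h10, ⟨α, hr⟩, h4, h3⟩ := h2
    rw [h11] at hr
    simp only [h11, hF.nat 0 (show 0 ∉ _ by simp), hc, hF.real 2 (show 2 ∉ _ by simp), herr,
      hI.column] at hr h4 h3 h10
    have hrem : ∀ x < m.nat 1, m₁.real 4 x = remaining (m.nat 1) (m₂.real 3) t x := fun x hx =>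
      (hI.eq_remaining x hx).trans (remaining_congr h3 le_rfl hx).symm
    refine ⟨by rw [h10, Nat.succ_mul], fun x hx => ?_, fun x hx => ?_, fun x hx => ?_,
      fun s hs => ?_⟩
    · rw [h4 x hx, hrem x hx]
      unfold remaining
      rw [Finset.sum_range_succ]
      ring
    · rw [h4 x hx]
      exact sub_nonneg.2 (hr.le ⟨x, hx⟩)
    · rw [h4 x hx]
      linarith [hr.nonneg ⟨x, hx⟩, hI.le_one x hx]
    · rcases Nat.lt_succ_iff_lt_or_eq.1 hs with h | rfl
      · exact (hI.isRoundAt s h).congr h3 h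
      · refine ⟨α, ?_⟩
        have h5 : (fun x : Fin (m.nat 1) => m₁.real 4 x)
            = fun x : Fin (m.nat 1) => remaining (m.nat 1) (m₂.real 3) s x := funext fun x => hrem x x.2
        rw [h5] at hr
        exact hr
  · have h1 : 1 ≤ thresholdCost m := (Nat.succ_le_of_lt (Nat.succ_pos _)).trans
      ((le_responsesCost m).trans (Nat.le_mul_of_pos_right _ (Nat.succ_pos _)))
    have := loop_cost_le (n := m.nat 2) (c := 310) (d := 10) (e := 8) (X := thresholdCost m) h1
    omega

/-! ### The precision -/

/-- The machine cannot convert reals to naturals, so a logarithm is obtained by counting doublings.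
`J` is any a priori bound and enters only the running time; `j` is the actual count. -/
theorem doublingProgram_ends (J : ℕ) (m : Memory) (hJ : 1 ≤ 2 ^ J * m.real 19 0) :
    Ends doublingProgram m (20 * (J + 1)) fun m' => Frame [3] [19] m m' ∧
      ∃ j ≤ J, m'.nat 3 = m.nat 3 + j ∧ 1 ≤ 2 ^ j * m.real 19 0 := by
  induction J generalizing m with
  | zero =>
    refine ⟨_, m, Runs.loopFalse ?_, ?_, Frame.refl, 0, le_rfl, by simp, hJ⟩
    · simpa using hJ
    · simp
  | succ J ih =>
    by_cases h : m.real 19 0 < 1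
    · set m₁ := m.putReal 19 0 (m.real 19 0 + m.real 19 0) with hm1
      set m₂ := m₁.putNat 3 (m₁.nat 3 + 1) with hm2
      have h19 : m₂.real 19 0 = 2 * m.real 19 0 := by
        simp [hm2, hm1, two_mul]
      have h3 : m₂.nat 3 = m.nat 3 + 1 := by simp [hm2, hm1]
      obtain ⟨n, m₃, hr, hn, hF, j, hj, hj3, hj1⟩ := ih m₂ (by rw [h19, ← mul_assoc, ← pow_succ]; exact hJ)
      have hF' : Frame [3] [19] m m₃ :=
        ((Frame.refl.putReal (by simp)).putNat (by simp)).trans hF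
      refine ⟨_, m₃, Runs.loopTrue (by simpa using h)
        (Runs.seq (Runs.setReal _ _ _ _) (Runs.setNat _ _ _)) hr, ?_, hF', j + 1, by omega,
        by omega, ?_⟩
      · simp
        omega
      · rw [h19] at hj1
        rw [pow_succ, mul_assoc]
        exact hj1
    · refine ⟨_, m, Runs.loopFalse (by simpa using h), ?_, Frame.refl, 0, Nat.zero_le _, by simp,
        by simpa using h⟩
      simp only [Test.cost, RealExp.cost, cost_scalar]
      omega

/-- The number of bisection steps before the doublings are counted. -/
def baseCount (m : Memory) : ℕ := 3 * (m.nat 0 + m.nat 1 + m.nat 2) + 10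

theorem precisionProgram_ends (J J' : ℕ) (m : Memory) (hJ : 1 ≤ 2 ^ J * m.real 0 0)
    (hJ' : 1 ≤ 2 ^ J' * m.real 2 (m.nat 1 - 1)) :
    Ends precisionProgram m (20 * (J + J') + 100) fun m' => Frame [3] [19] m m' ∧
      ∃ j ≤ J, ∃ j' ≤ J', m'.nat 3 = baseCount m + j + j' ∧ 1 ≤ 2 ^ j * m.real 0 0 ∧
        1 ≤ 2 ^ j' * m.real 2 (m.nat 1 - 1) := by
  set m₁ := (m.putNat 3 (baseSteps.eval m)).putReal 19 0 (m.real 0 0) with hm1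
  have hF1 : Frame [3] [19] m m₁ := (Frame.refl.putNat (by simp)).putReal (by simp)
  have h13 : m₁.nat 3 = baseCount m := by
    simp only [hm1, baseSteps, baseCount, NatExp.eval, Memory.putReal_nat, Memory.putNat_nat_self]
    omega
  have h1 := doublingProgram_ends J m₁ (by simpa [hm1] using hJ)
  refine Ends.le (Ends.setNat_seq (Ends.setReal_seq (h1.seq (Q' := fun m' => Frame [3] [19] m m' ∧
      ∃ j ≤ J, ∃ j' ≤ J', m'.nat 3 = baseCount m + j + j' ∧ 1 ≤ 2 ^ j * m.real 0 0 ∧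
        1 ≤ 2 ^ j' * m.real 2 (m.nat 1 - 1)) fun m₂ h2 => Ends.setReal_seq
          (Ends.mono (doublingProgram_ends J' _ ?_) le_rfl fun m' h => ?_)))) ?_
  · simpa [h2.1.real 2, h2.1.nat 1, hF1.real 2, hF1.nat 1] using hJ'
  · obtain ⟨hF2, j, hj, hj3, hj1⟩ := h2
    obtain ⟨hF, j', hj', hj3', hj1'⟩ := h
    refine ⟨hF1.trans (hF2.trans (Frame.trans (Frame.refl.putReal (by simp)) hF)), j, hj, j', hj',
      ?_, by simpa [hm1] using hj1, by
        simpa [hF2.real 2, hF2.nat 1, hF1.real 2, hF1.nat 1] using hj1'⟩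
    rw [hj3', Memory.putReal_nat, hj3, h13]
  · simp [baseSteps]
    omega

/-! ### The whole program -/

/-- The memory holds the input of the algorithm. -/
structure IsInput (m : Memory) : Prop where
  pos : 0 < m.nat 0
  coeff_nonneg : ∀ ℓ, 0 ≤ coeffs m ℓ
  coeff_le_one : ∀ ℓ, coeffs m ℓ ≤ 1
  antitone : Antitone (coeffs m)
  prob_nonneg : ∀ x < m.nat 1, 0 ≤ m.real 2 x
  prob_le_one : ∀ x < m.nat 1, m.real 2 x ≤ 1
  column : m.nat 10 = 0

/-- In the time bound, `k ^ 2` comes from de Casteljau's recursion, the squared factor from the two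
nested bisections, and the last two factors from boxes and rounds. -/
theorem program_ends (J J' : ℕ) (m : Memory) (hm : IsInput m) (hJ : 1 ≤ 2 ^ J * m.real 0 0)
    (hJ' : 1 ≤ 2 ^ J' * m.real 2 (m.nat 1 - 1)) :
    Ends program m (500 * ((m.nat 0 + 1) ^ 2 * (baseCount m + J + J' + 1) ^ 2 * (m.nat 1 + 1) *
      (m.nat 2 + 1))) fun m' =>
      (∃ j j', 1 ≤ 2 ^ j * m.real 0 0 ∧ 1 ≤ 2 ^ j' * m.real 2 (m.nat 1 - 1) ∧
        ∀ s < m.nat 2, IsRoundAt (m.nat 1) (m.nat 0 - 1) (coeffs m) (m.real 2)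
          (((m.nat 0 - 1 : ℕ) + 4) / 2 ^ (baseCount m + j + j')) (m'.real 3) s) ∧
      ∀ x < m.nat 1, 0 ≤ remaining (m.nat 1) (m'.real 3) (m.nat 2) x := by
  set G := (m.nat 0 + 1) ^ 2 * (baseCount m + J + J' + 1) ^ 2 * (m.nat 1 + 1) * (m.nat 2 + 1)
    with hG
  refine Ends.le (Ends.seq (precisionProgram_ends J J' m hJ hJ') (Q' := fun m' =>
      (∃ j j', 1 ≤ 2 ^ j * m.real 0 0 ∧ 1 ≤ 2 ^ j' * m.real 2 (m.nat 1 - 1) ∧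
        ∀ s < m.nat 2, IsRoundAt (m.nat 1) (m.nat 0 - 1) (coeffs m) (m.real 2)
          (((m.nat 0 - 1 : ℕ) + 4) / 2 ^ (baseCount m + j + j')) (m'.real 3) s) ∧
      ∀ x < m.nat 1, 0 ≤ remaining (m.nat 1) (m'.real 3) (m.nat 2) x)
    (B' := m.nat 1 * (3 + 10) + 8 + 330 * G) fun m₁ h1 => ?_) ?_
  · obtain ⟨hF1, j, hj, j', hj', h13, hj1, hj1'⟩ := h1
    have h11 : m₁.nat 1 = m.nat 1 := hF1.nat 1 (by simp)
    refine Ends.seq (Ends.forLoop (R := []) (A := [4]) (B := 3) (n := m.nat 1)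
      (I := fun i m' => ∀ x < i, m'.real 4 x = 1)
      (by simp) (by simp) (fun m' hF => (eval_reg_of_frame hF (by simp)).trans h11)
      (fun _ _ _ h => h) (fun x hx => absurd hx (Nat.not_lt_zero x)) ?_) fun m₂ h2 => ?_
    · intro i m₂ _ hi _ hI
      refine Ends.setReal ⟨Frame.refl.putReal (by simp), fun x hx => ?_⟩
      simp only [NatExp.eval, RealExp.eval, hi]
      rcases Nat.lt_succ_iff_lt_or_eq.1 hx with h | rfl
      · rw [Memory.putReal_real_of_cell_ne _ _ _ _ h.ne]
        exact hI x h
      · simp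
    · obtain ⟨hF2', h4⟩ := h2
      have hF2 : Frame [3, 6] [4, 19] m m₂ :=
        (hF1.mono (by simp) (by simp)).trans (hF2'.mono (by simp) (by simp))
      have h20 : m₂.nat 0 = m.nat 0 := hF2.nat 0 (by simp)
      have h21 : m₂.nat 1 = m.nat 1 := hF2.nat 1 (by simp)
      have h22 : m₂.nat 2 = m.nat 2 := hF2.nat 2 (by simp)
      have h23 : m₂.nat 3 = baseCount m + j + j' := (hF2'.nat 3 (by simp)).trans h13
      have hc : coeffs m₂ = coeffs m := by
        unfold coeffs
        rw [hF2.real 1 (by simp)]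
      have hr2 : m₂.real 2 = m.real 2 := hF2.real 2 (by simp)
      have hm2 : Ready m₂ := by
        refine ⟨by rw [h20]; exact hm.pos, ?_⟩
        rw [h21, hc, hr2]
        exact ⟨hm.coeff_nonneg, hm.coeff_le_one, hm.antitone, hm.prob_nonneg, hm.prob_le_one,
          fun x hx => by rw [h4 x hx]; exact zero_le_one, fun x hx => (h4 x hx).le⟩
      have hS : IsRoundsState m₂ 0 m₂ := by
        refine ⟨by rw [hF2.nat 10 (by simp), hm.column, zero_mul], fun x hx => ?_,
          hm2.data.nonneg, hm2.data.le_one, fun s hs => absurd hs (Nat.not_lt_zero s)⟩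
        rw [h4 x (h21 ▸ hx)]
        simp [remaining]
      refine (rounds_ends m₂ hm2 hS).mono ?_ fun m₃ h3 => ⟨⟨j, j', hj1, hj1', fun s hs => ?_⟩,
        fun x hx => ?_⟩
      · refine Nat.mul_le_mul_left _ ?_
        unfold thresholdCost responsesCost responseCost
        rw [h20, h21, h22, h23, hG]
        have h5 : baseCount m + j + j' + 1 ≤ baseCount m + J + J' + 1 := by omega
        calc (m.nat 0 + 1) ^ 2 * (baseCount m + j + j' + 1) * (m.nat 1 + 1)
              * (baseCount m + j + j' + 1) * (m.nat 2 + 1)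
            ≤ (m.nat 0 + 1) ^ 2 * (baseCount m + J + J' + 1) * (m.nat 1 + 1)
              * (baseCount m + J + J' + 1) * (m.nat 2 + 1) := by gcongr
          _ = _ := by ring
      · have h5 := h3.isRoundAt s (h22 ▸ hs)
        have herr : roundError m₂ = ((m.nat 0 - 1 : ℕ) + 4) / 2 ^ (baseCount m + j + j') := by
          unfold roundError responseError
          rw [h20, h23]
          ring
        rwa [h20, h21, hc, hr2, herr] at h5
      · have h5 := h3.nonneg x (h21 ▸ hx)
        rwa [h3.eq_remaining x (h21 ▸ hx), h21, h22] at h5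
  · have h1 : baseCount m + J + J' + 1 ≤ G := by
      rw [hG, mul_assoc, mul_assoc, mul_left_comm, sq (baseCount m + J + J' + 1), mul_assoc]
      exact Nat.le_mul_of_pos_right _ (by positivity)
    have h2 : m.nat 1 ≤ baseCount m := by
      unfold baseCount
      omega
    have h3 : 10 ≤ baseCount m := by
      unfold baseCount
      omega
    omega

end SearchGame.Algorithm

namespace SearchGame

/-! ### From the output of the program to an equilibrium -/

theorem IsRound.mono {M n : ℕ} {b : ℕ → ℝ} {f w a : Fin M → ℝ} {η η' α : ℝ}
    (h : IsRound n b f w a η α) (hη : η ≤ η') : IsRound n b f w a η' α :=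
  ⟨h.nonneg, h.le, h.sum_le, h.threshold_nonneg, h.full, fun x => (h.lower x).trans hη, h.upper⟩

/-- The memory holds zeros beyond `C k`, where the policy itself may not vanish; a polynomial of
degree `k - 1` does not see the difference. -/
theorem IsRound.congr_coeff {M n : ℕ} {b b' : ℕ → ℝ} {f w a : Fin M → ℝ} {η α : ℝ}
    (h : IsRound n b f w a η α) (hb : ∀ ℓ ≤ n, b ℓ = b' ℓ) : IsRound n b' f w a η α :=
  ⟨h.nonneg, h.le, h.sum_le, h.threshold_nonneg, h.full,
    fun x => bern_congr hb (a x) (w x - a x) ▸ h.lower x,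
    fun x => bern_congr hb (a x) (w x - a x) ▸ h.upper x⟩

open Algorithm RealRAM

section Input

variable (c : Configuration) (θ : ℝ)

theorem coeffs_inputMemory (ℓ : ℕ) :
    coeffs (inputMemory c θ) ℓ = if ℓ + 1 ≤ c.k then c.coeff ℓ else 0 := by
  simp [coeffs, inputMemory, Configuration.coeff]

theorem inputMemory_prob (x : Fin c.M) : (inputMemory c θ).real 2 x = c.f x := by
  simp [inputMemory]

theorem isInput_inputMemory : IsInput (inputMemory c θ) := by
  refine ⟨by have := c.two_le_k; simp [inputMemory]; omega, fun ℓ => ?_, fun ℓ => ?_,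
    fun i j hij => ?_, fun x hx => ?_, fun x hx => ?_, by simp [inputMemory]⟩
  · rw [coeffs_inputMemory]
    split_ifs
    exacts [c.coeff_nonneg ℓ, le_rfl]
  · rw [coeffs_inputMemory]
    split_ifs
    exacts [c.coeff_le_one ℓ, zero_le_one]
  · rw [coeffs_inputMemory, coeffs_inputMemory]
    split_ifs with h1 h2
    · exact c.coeff_antitone hij
    · omega
    · exact c.coeff_nonneg i
    · exact le_rfl
  · exact (inputMemory_prob c θ ⟨x, hx⟩).symm ▸ (c.f_pos _).le
  · exact (inputMemory_prob c θ ⟨x, hx⟩).symm ▸ c.f_le_one _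

end Input

/-- The error of the algorithm is small enough. -/
theorem error_le {T M k j j' : ℕ} {p q : ℝ} (hk : 2 ≤ k) (hp : 1 ≤ 2 ^ j * p)
    (hq : 1 ≤ 2 ^ j' * q) :
    2 * (T * M * (((k - 1 : ℕ) + 4 : ℝ) / 2 ^ (3 * (k + M + T) + 10 + j + j')))
      ≤ p * (q * (1 / 2) ^ (k - 1)) := by
  obtain ⟨n, rfl⟩ : ∃ n, k = n + 1 := ⟨k - 1, by omega⟩
  rw [Nat.add_sub_cancel]
  have hT : (T : ℝ) ≤ 2 ^ T := by exact_mod_cast T.lt_two_pow_self.le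
  have hM : (M : ℝ) ≤ 2 ^ M := by exact_mod_cast M.lt_two_pow_self.le
  have hn : (n : ℝ) + 4 ≤ 2 ^ n * 4 := by
    have : (n : ℝ) + 1 ≤ 2 ^ n := by exact_mod_cast n.lt_two_pow_self
    linarith
  have h1 : 2 * (T * M * ((n : ℝ) + 4)) ≤ 2 * (2 ^ T * 2 ^ M * (2 ^ n * 4)) := by gcongr
  -- The base number of steps absorbs `T`, `M`, `k` and the factor `2 ^ (k - 1)`; the doublings `j`
  -- and `j'` absorb `p` and `q`.
  have h2 : 2 * (2 ^ T * 2 ^ M * (2 ^ n * 4)) * 2 ^ n ≤ (2 : ℝ) ^ (3 * (n + 1 + M + T) + 10) := by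
    have h3 : 2 * (2 ^ T * 2 ^ M * (2 ^ n * 4)) * 2 ^ n = (2 : ℝ) ^ (T + M + n + n + 3) := by
      rw [pow_add, pow_add, pow_add, pow_add]
      ring
    rw [h3]
    exact pow_le_pow_right₀ one_le_two (by omega)
  have h4 : 1 ≤ 2 ^ j * p * (2 ^ j' * q) := one_le_mul_of_one_le_of_one_le hp hq
  have h5 : (0 : ℝ) < 2 ^ (3 * (n + 1 + M + T) + 10 + j + j') := by positivity
  have h6 : 2 * (T * M * (((n : ℝ) + 4) / 2 ^ (3 * (n + 1 + M + T) + 10 + j + j')))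
      = 2 * (T * M * ((n : ℝ) + 4)) / 2 ^ (3 * (n + 1 + M + T) + 10 + j + j') := by ring
  have h7 : p * (q * (1 / 2) ^ n) = p * q / 2 ^ n := by
    rw [one_div, inv_pow]
    ring
  rw [h6, h7, div_le_div_iff₀ h5 (by positivity)]
  calc 2 * (T * M * ((n : ℝ) + 4)) * 2 ^ n
      ≤ 2 * (2 ^ T * 2 ^ M * (2 ^ n * 4)) * 2 ^ n := by gcongr
    _ ≤ 2 ^ (3 * (n + 1 + M + T) + 10) := h2
    _ ≤ 2 ^ (3 * (n + 1 + M + T) + 10) * (2 ^ j * p * (2 ^ j' * q)) :=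
        le_mul_of_one_le_right (by positivity) h4
    _ = p * q * 2 ^ (3 * (n + 1 + M + T) + 10 + j + j') := by
        rw [pow_add _ _ j', pow_add _ _ j]
        ring

/-- The column sums are bounded by the round conditions and the row sums by the nonnegativity of
`remaining`, so the output is the matrix of a strategy. -/
theorem exists_isSymmetricApproxEquilibrium {c : Configuration} {θ : ℝ} (hθ : 0 < θ) {j j' : ℕ}
    {m : Memory} (hj : 1 ≤ 2 ^ j * θ) (hj' : 1 ≤ 2 ^ j' * c.f c.lastBox)
    (hround : ∀ s < c.T, IsRoundAt c.M (c.k - 1) (coeffs (inputMemory c θ))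
      ((inputMemory c θ).real 2)
      (((c.k - 1 : ℕ) + 4) / 2 ^ (3 * (c.k + c.M + c.T) + 10 + j + j')) (m.real 3) s)
    (hrow : ∀ x < c.M, 0 ≤ remaining c.M (m.real 3) c.T x) :
    ∃ A : Strategy c.M c.T, A.matrix = outputMatrix c.M c.T m ∧
      IsSymmetricApproxEquilibrium c ((1 + c.C c.k) * (1 + θ)) A := by
  classical
  set η : ℝ := ((c.k - 1 : ℕ) + 4) / 2 ^ (3 * (c.k + c.M + c.T) + 10 + j + j') with hη
  have hη0 : 0 ≤ η := by positivity
  choose! α hα using hround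
  have hα' : ∀ t : Fin c.T, IsRound (c.k - 1) c.coeff c.f
      (fun x => remaining c.M (m.real 3) t x) (fun x => outputMatrix c.M c.T m x t)
      (if 1 < ∑ x : Fin c.M, remaining c.M (m.real 3) t x then η else 0) (α t) := by
    intro t
    have h := (hα t t.2).congr_coeff (b' := c.coeff) fun ℓ hℓ => by
      rw [coeffs_inputMemory, if_pos (by have := c.two_le_k; omega)]
    simp only [inputMemory_prob] at h
    exact h
  have hrow' : ∀ x : Fin c.M, ∑ t, outputMatrix c.M c.T m x t ≤ 1 := by
    intro x
    have h := hrow x x.2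
    unfold remaining at h
    unfold outputMatrix
    rw [Fin.sum_univ_eq_sum_range (fun t => m.real 3 (t * c.M + x)) c.T]
    linarith
  obtain ⟨A, hA⟩ := exists_strategy_matrix_eq (fun x t => (hα' t).nonneg x) hrow'
    fun t => (hα' t).sum_le
  have hunvisited : ∀ t : Fin c.T, A.unvisited t = fun x : Fin c.M => remaining c.M (m.real 3) t x := by
    intro t
    funext x
    unfold Strategy.unvisited remaining
    rw [hA, Finset.sum_filter]
    unfold outputMatrix
    have h1 : ∀ s : Fin c.T, (if s < t then m.real 3 (s.val * c.M + x) else 0)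
        = (fun s : ℕ => if s < t.val then m.real 3 (s * c.M + x) else 0) s := fun s => by
      simp only [Fin.lt_def]
    rw [Finset.sum_congr rfl fun s _ => h1 s, Fin.sum_univ_eq_sum_range
      (fun s => if s < t.val then m.real 3 (s * c.M + x) else 0) c.T, ← Finset.sum_filter]
    congr 2
    ext s
    simp only [Finset.mem_filter, Finset.mem_range]
    exact ⟨fun h => h.2, fun h => ⟨h.trans t.2, h⟩⟩
  refine ⟨A, hA, ?_⟩
  have hround : ∀ t, IsRound (c.k - 1) c.coeff c.f (A.unvisited t) (fun x => A.matrix x t)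
      (if 1 < ∑ x : Fin c.M, A.unvisited t x then η else 0) (α t) := by
    intro t
    rw [hunvisited t, hA]
    exact hα' t
  rcases Nat.lt_or_ge 1 c.M with hM | hM
  · refine isSymmetricApproxEquilibrium_of_isRound hη0 hθ
      (fun t => ⟨α t, (hround t).mono (by split_ifs; exacts [le_rfl, hη0])⟩) (Or.inr ⟨hM, ?_, ?_⟩)
    -- The smallness condition without `θ`: take `p = 1` and no doublings for it; the actual
    -- exponent is only larger.
    · have h := error_le (T := c.T) (M := c.M) (j := 0) (p := 1) c.two_le_k (by simp) hj'
      rw [one_mul] at h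
      refine le_trans ?_ h
      rw [hη]
      gcongr
      · exact one_le_two
      · omega
    · exact error_le c.two_le_k hj hj'
  -- If `C k = 0`, the utility is 0 and no error could be tolerated. With one box the `w x` sum to
  -- at most 1, so every round has error 0.
  · have hM1 : c.M = 1 := le_antisymm hM c.M_pos
    refine isSymmetricApproxEquilibrium_of_isRound le_rfl hθ (fun t => ⟨α t, ?_⟩)
      (Or.inl ⟨hM1, rfl⟩)
    have h := hround t
    rwa [if_neg] at h
    have h1 : ∀ x, A.unvisited t x ≤ 1 :=
      fun x => sub_le_self _ (Finset.sum_nonneg fun s _ => A.matrix_nonneg x s)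
    have h2 := Finset.sum_le_sum fun x (_ : x ∈ Finset.univ) => h1 x
    rw [Finset.sum_const, Finset.card_univ, Fintype.card_fin, nsmul_one] at h2
    exact (h2.trans (by rw [hM1, Nat.cast_one])).not_gt

/-- Enough doublings lead from `r` to a number that is at least `1`. -/
theorem one_le_two_pow_ceil_mul {r : ℝ} (hr : 0 < r) :
    1 ≤ 2 ^ ⌈2 * max 0 (Real.log (1 / r))⌉₊ * r := by
  set J := ⌈2 * max 0 (Real.log (1 / r))⌉₊
  have h1 : 2 * max 0 (Real.log (1 / r)) ≤ J := Nat.le_ceil _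
  have h2 : Real.log (1 / r) ≤ J * Real.log 2 := by
    -- The factor 2 in the ceiling makes up for `log 2 < 1`.
    have h3 : (1 / 2 : ℝ) ≤ Real.log 2 := by linarith [Real.log_two_gt_d9]
    nlinarith [le_max_right 0 (Real.log (1 / r)), (Nat.cast_nonneg J : (0 : ℝ) ≤ J)]
  rw [← Real.log_pow] at h2
  have h3 := (Real.log_le_log_iff (by positivity) (by positivity)).1 h2
  rwa [div_le_iff₀ hr] at h3

/-! ### The polynomial time bound -/

/-- A bound for the running time of the algorithm. -/
noncomputable def timeBound : MvPolynomial (Fin 6) ℝ :=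
  MvPolynomial.C 500 * ((MvPolynomial.X 1 + 1) ^ 2 *
    (MvPolynomial.C 2 * MvPolynomial.X 3 + MvPolynomial.C 2 * MvPolynomial.X 5 +
      MvPolynomial.C 3 * (MvPolynomial.X 1 + MvPolynomial.X 2 + MvPolynomial.X 0) +
      MvPolynomial.C 13) ^ 2 * (MvPolynomial.X 2 + 1) * (MvPolynomial.X 0 + 1))

theorem eval_timeBound (c : Configuration) (θ : ℝ) :
    MvPolynomial.eval (sizeParameters c θ) timeBound = 500 * (((c.k : ℝ) + 1) ^ 2 *
      (2 * max 0 (Real.log (1 / θ)) + 2 * Real.log (1 / c.f c.lastBox) + 3 * (c.k + c.M + c.T) + 13)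
        ^ 2 * (c.M + 1) * (c.T + 1)) := by
  simp [timeBound, sizeParameters]

theorem cost_le_timeBound (c : Configuration) (θ : ℝ) :
    ((500 * ((c.k + 1) ^ 2 * (3 * (c.k + c.M + c.T) + 10 + ⌈2 * max 0 (Real.log (1 / θ))⌉₊ +
      ⌈2 * max 0 (Real.log (1 / c.f c.lastBox))⌉₊ + 1) ^ 2 * (c.M + 1) * (c.T + 1)) : ℕ) : ℝ)
      ≤ MvPolynomial.eval (sizeParameters c θ) timeBound := by
  rw [eval_timeBound]
  have h1 : 0 ≤ Real.log (1 / c.f c.lastBox) :=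
    Real.log_nonneg ((one_le_div (c.f_pos _)).2 (c.f_le_one _))
  have h2 := (Nat.ceil_lt_add_one (a := 2 * max 0 (Real.log (1 / θ))) (by positivity)).le
  have h3 := (Nat.ceil_lt_add_one (a := 2 * max 0 (Real.log (1 / c.f c.lastBox)))
    (by positivity)).le
  rw [max_eq_right h1] at h3 ⊢
  push_cast
  -- The constant is `13 = 10 + 1 + 2`, each of the two ceilings costing at most 1.
  have h4 : 3 * ((c.k : ℝ) + c.M + c.T) + 10 + ⌈2 * max 0 (Real.log (1 / θ))⌉₊ +
      ⌈2 * Real.log (1 / c.f c.lastBox)⌉₊ + 1 ≤ 2 * max 0 (Real.log (1 / θ)) +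
        2 * Real.log (1 / c.f c.lastBox) + 3 * (c.k + c.M + c.T) + 13 := by linarith
  gcongr

end SearchGame

/-- One program, on input a configuration and `θ > 0`, computes in polynomial time the probability
matrix of a strategy that is a symmetric `(1 + C(k))(1 + θ)`-equilibrium. -/
theorem theorem3 :
    ∃ (p : RealRAM.Program) (P : MvPolynomial (Fin 6) ℝ),
      ∀ (c : SearchGame.Configuration) (θ : ℝ), 0 < θ →
        ∃ (n : ℕ) (m : RealRAM.Memory),
          RealRAM.Runs p (SearchGame.inputMemory c θ) n m ∧
          (n : ℝ) ≤ MvPolynomial.eval (SearchGame.sizeParameters c θ) P ∧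
          ∃ A : SearchGame.Strategy c.M c.T,
            A.matrix = SearchGame.outputMatrix c.M c.T m ∧
            SearchGame.IsSymmetricApproxEquilibrium c ((1 + c.C c.k) * (1 + θ)) A := by
  refine ⟨SearchGame.Algorithm.program, SearchGame.timeBound, fun c θ hθ => ?_⟩
  have hlast : (SearchGame.inputMemory c θ).real 2 (c.M - 1) = c.f c.lastBox :=
    SearchGame.inputMemory_prob c θ c.lastBox
  obtain ⟨n, m, hrun, hn, ⟨j, j', hj, hj', hround⟩, hrow⟩ :=
    SearchGame.Algorithm.program_ends ⌈2 * max 0 (Real.log (1 / θ))⌉₊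
      ⌈2 * max 0 (Real.log (1 / c.f c.lastBox))⌉₊ (SearchGame.inputMemory c θ)
      (SearchGame.isInput_inputMemory c θ) (SearchGame.one_le_two_pow_ceil_mul hθ)
      (hlast.symm ▸ SearchGame.one_le_two_pow_ceil_mul (c.f_pos c.lastBox))
  exact ⟨n, m, hrun, (Nat.cast_le.2 hn).trans (SearchGame.cost_le_timeBound c θ),
    SearchGame.exists_isSymmetricApproxEquilibrium hθ hj (hlast ▸ hj') hround hrow⟩
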